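/- **Definitions.** A *computable metric space* is a complete metric space $(X,d)$ with a dense sequence $(s_i)_{i\in\mathbb N}$ of *ideal points* such that the reals $d(s_i,s_j)$ are computable uniformly in $(i,j)$. A *name* of $x\in X$ is a $\sigma\in\mathbb N^{\mathbb N}$ with $d(s_{\sigma_n},s_{\sigma_{n+1}})<2^{-n}$ for all $n$ and $s_{\sigma_n}\to x$; the point $x$ is computable if it has a recursive name. A partial function $\mathbb N^{\mathbb N}\to\mathbb N^{\mathbb N}$ is recursive if, at each $\sigma$ of its domain, its value is the limit of the values of some recursive prefix-monotone map $\mathbb N^*\to\mathbb N^*$ on the prefixes of $\sigma$. A function $f:D\to Y$, with $D\subseteq X$, between computable metric spaces is *computable* if some recursive partial function maps every name of every $x\in D$ to a name of $f(x)$. The *ideal balls* are the $B(s_i,q)$ with $q\in\mathbb Q_{>0}$; a sequence of open sets is *uniformly r.e.* if its members are unions of uniformly recursively enumerable families of ideal balls, and a $\Pi^0_2$-set is an intersection $\bigcap_n U_n$ of a uniformly r.e. sequence. A Borel probability measure on $X$ is *computable* if it is a computable point of the space of Borel probability measures with the Prokhorov metric, the ideal points being the measures concentrated on finitely many ideal points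 of $X$ with rational weights. A *computable probability space* $(X,\mu)$ is a computable metric space with a computable Borel probability measure. A *morphism* $F:(X,\mu)\to(Y,\nu)$ is a computable function $F:D_F\to Y$, where $D_F\subseteq X$ is a $\Pi^0_2$-set with $\mu(D_F)=1$, such that $\nu(A)=\mu(F^{-1}(A))$ for all Borel sets $A\subseteq Y$. An *isomorphism* is a pair of morphisms $F:(X,\mu)\to(Y,\nu)$ and $G:(Y,\nu)\to(X,\mu)$ with $G\circ F=\mathrm{id}$ on $F^{-1}(D_G)$ and $F\circ G=\mathrm{id}$ on $G^{-1}(D_F)$. The Cantor space $2^\omega$ carries the metric $d(\omega,\omega')=2^{-\min\{n:\omega_n\ne\omega'_n\}}$ (and $d(\omega,\omega)=0$), its ideal points being the sequences that are eventually $0$. A *binary representation* of $(X,\mu)$ is a pair $(\delta,\mu_\delta)$, where $\mu_\delta$ is a computable probability measure on $2^\omega$ and $\delta:(2^\omega,\mu_\delta)\to(X,\mu)$ is a morphism that maps its domain onto $X$, such that there is a dense $\Pi^0_2$-set $D\subseteq X$ with $\mu(D)=1$ for which every $x\in D$ has exactly one preimage $\delta^{-1}(x)$ (its *expansion*) and $\delta^{-1}:D\to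 2^\omega$ is computable. **Theorem.** Every computable probability space $(X,\mu)$ has a binary representation. Moreover, for every binary representation $(\delta,\mu_\delta)$ of $(X,\mu)$ and every set $D$ as in the definition, the pair $(\delta,\delta^{-1}|_D)$ is an isomorphism between $(2^\omega,\mu_\delta)$ and $(X,\mu)$. Consequently $(X,\mu)$ is isomorphic to the Cantor space with some computable probability measure. -/

import Mathlib

open MeasureTheory Filter Topology
open scoped ENNReal

namespace ComputableProbability

/-! ### Recursive functions on Baire space -/

/-- The prefix `σ 0, …, σ (n - 1)` of a sequence. -/
def initSeg (σ : ℕ → ℕ) (n : ℕ) : List ℕ := (List.range n).map σ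

/-- A partial function `F : ℕ^ℕ → ℕ^ℕ` is recursive if there is a recursive function `F'` on finite
sequences, monotone for the prefix ordering, such that for every `σ` in the domain of `F` the
infinite sequence `F σ` is the limit of the values of `F'` on the prefixes of `σ`. -/
def RecursiveOperator (F : (ℕ → ℕ) →. (ℕ → ℕ)) : Prop :=
  ∃ F' : List ℕ → List ℕ, Computable F' ∧ (∀ u v, u <+: v → F' u <+: F' v) ∧
    ∀ σ, ∀ τ ∈ F σ, ∀ n, ∃ k, initSeg τ n <+: F' (initSeg σ k)

/-! ### Cauchy representation, computable metric spaces -/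

/-- `σ` is a name of `x` for the Cauchy representation given by the ideal points `s i`: the sequence
`s (σ n)` is fast and converges to `x`. -/
def CauchyName {X : Type*} [PseudoMetricSpace X] (s : ℕ → X) (σ : ℕ → ℕ) (x : X) : Prop :=
  (∀ n, dist (s (σ n)) (s (σ (n + 1))) < (1 / 2 : ℝ) ^ n) ∧
    Tendsto (fun n => s (σ n)) atTop (𝓝 x)

/-- A constructive point for the Cauchy representation. -/
def ConstructivePoint {X : Type*} [PseudoMetricSpace X] (s : ℕ → X) (x : X) : Prop :=
  ∃ σ : ℕ → ℕ, Computable σ ∧ CauchyName s σ x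

/-- Uniformly constructive points for the Cauchy representation. -/
def UniformlyConstructive {α X : Type*} [Primcodable α] [PseudoMetricSpace X] (s : ℕ → X)
    (x : α → X) : Prop :=
  ∃ σ : α → ℕ → ℕ, Computable₂ σ ∧ ∀ a, CauchyName s (σ a) (x a)

/-- The numbering `⟨⟨a, b⟩, c⟩ ↦ (a - b) / (c + 1)` of the rational numbers. -/
def ratNum (n : ℕ) : ℚ :=
  ((n.unpair.1.unpair.1 : ℚ) - (n.unpair.1.unpair.2 : ℚ)) / ((n.unpair.2 : ℚ) + 1)

/-- The numbering `⟨a, b⟩ ↦ (a + 1) / (b + 1)` of the positive rational numbers. -/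
def posRatNum (n : ℕ) : ℚ := ((n.unpair.1 : ℚ) + 1) / ((n.unpair.2 : ℚ) + 1)

/-- A computable metric space: a complete metric space with a numbered dense set of ideal points
whose mutual distances are uniformly computable real numbers. -/
class ComputableMetricSpace (X : Type*) [MetricSpace X] extends CompleteSpace X where
  /-- The numbering of the ideal points. -/
  ideal : ℕ → X
  denseRange_ideal : DenseRange ideal
  dist_computable : UniformlyConstructive (fun n => (ratNum n : ℝ))
    (fun p : ℕ × ℕ => dist (ideal p.1) (ideal p.2))


section Topology

variable {X Y : Type*} [MetricSpace X] [ComputableMetricSpace X]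
  [MetricSpace Y] [ComputableMetricSpace Y]

/-- The numbering of the ideal balls `B(s, q)`, `s` an ideal point and `q` a positive rational. -/
def idealBall (X : Type*) [MetricSpace X] [ComputableMetricSpace X] (n : ℕ) : Set X :=
  Metric.ball (ComputableMetricSpace.ideal n.unpair.1) (posRatNum n.unpair.2 : ℝ)

/-- Uniformly r.e. open sets: each `U n` is the union of a set of ideal balls that is recursively
enumerable, uniformly in `n`. -/
def UniformlyREOpen (U : ℕ → Set X) : Prop :=
  ∃ E : ℕ × ℕ → Prop, REPred E ∧ ∀ n, U n = ⋃ i ∈ {i | E (n, i)}, idealBall X i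

/-- `Π⁰₂` subsets of a computable metric space. -/
def IsPiZeroTwo (A : Set X) : Prop :=
  ∃ U : ℕ → Set X, UniformlyREOpen U ∧ A = ⋂ n, U n

/-- A function `f : D → Y` on a subset `D` of `X` is computable if some recursive operator maps every
name of every point `x ∈ D` to a name of `f x`. -/
def ComputableOn {D : Set X} (f : D → Y) : Prop :=
  ∃ F : (ℕ → ℕ) →. (ℕ → ℕ), RecursiveOperator F ∧
    ∀ (x : D) (σ : ℕ → ℕ), CauchyName ComputableMetricSpace.ideal σ (x : X) →
      ∃ τ ∈ F σ, CauchyName ComputableMetricSpace.ideal τ (f x)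

end Topology

/-! ### The Cantor space -/

/-- The metric `d(ω, ω') = 2 ^ (-min {n | ω n ≠ ω' n})` on the Cantor space. -/
noncomputable instance cantorMetricSpace : MetricSpace (ℕ → Bool) :=
  PiNat.metricSpaceOfDiscreteUniformity (fun _ => rfl)

/-- The length of the common binary prefix of two distinct natural numbers. -/
def agreeLength (i j : ℕ) : ℕ := Nat.findGreatest (fun n => i % 2 ^ n = j % 2 ^ n) (i + j)

theorem agreeLength_primrec : Primrec₂ agreeLength := by
  have hpow : Primrec₂ ((· ^ ·) : ℕ → ℕ → ℕ) := Primrec₂.unpaired'.1 Nat.Primrec.pow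
  have hn : Primrec fun q : (ℕ × ℕ) × (ℕ × ℕ) => q.2.1 + 1 :=
    Primrec.succ.comp (Primrec.fst.comp Primrec.snd)
  have hp : Primrec fun q : (ℕ × ℕ) × (ℕ × ℕ) => 2 ^ (q.2.1 + 1) :=
    hpow.comp (Primrec.const 2) hn
  have hc : PrimrecPred fun q : (ℕ × ℕ) × (ℕ × ℕ) =>
      q.1.1 % 2 ^ (q.2.1 + 1) = q.1.2 % 2 ^ (q.2.1 + 1) :=
    Primrec.eq.comp (Primrec.nat_mod.comp (Primrec.fst.comp Primrec.fst) hp)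
      (Primrec.nat_mod.comp (Primrec.snd.comp Primrec.fst) hp)
  have hh : Primrec₂ fun (a : ℕ × ℕ) (b : ℕ × ℕ) =>
      if a.1 % 2 ^ (b.1 + 1) = a.2 % 2 ^ (b.1 + 1) then b.1 + 1 else b.2 :=
    Primrec.ite hc hn (Primrec.snd.comp Primrec.snd)
  refine (Primrec.nat_rec' (f := fun a : ℕ × ℕ => a.1 + a.2)
    (Primrec.nat_add.comp Primrec.fst Primrec.snd) (Primrec.const 0) hh).of_eq ?_
  rintro ⟨i, j⟩
  show _ = agreeLength i j
  unfold agreeLength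
  dsimp only
  induction i + j with
  | zero => simp
  | succ n ih => rw [Nat.findGreatest_succ, ← ih]

theorem mod_two_pow_eq_iff (i j n : ℕ) :
    i % 2 ^ n = j % 2 ^ n ↔ ∀ m < n, i.testBit m = j.testBit m := by
  constructor
  · intro h m hm
    have := congrArg (fun k => Nat.testBit k m) h
    simpa [Nat.testBit_mod_two_pow, hm] using this
  · intro h
    apply Nat.eq_of_testBit_eq
    intro m
    by_cases hm : m < n
    · simp [Nat.testBit_mod_two_pow, hm, h m hm]
    · simp [Nat.testBit_mod_two_pow, hm]

theorem cantor_dist_testBit (i j : ℕ) (h : i ≠ j) :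
    dist i.testBit j.testBit = (1 / 2 : ℝ) ^ agreeLength i j := by
  have hne : i.testBit ≠ j.testBit := fun e => h (Nat.eq_of_testBit_eq (congrFun e))
  have hd : dist i.testBit j.testBit = (1 / 2 : ℝ) ^ PiNat.firstDiff i.testBit j.testBit :=
    PiNat.dist_eq_of_ne (E := fun _ => Bool) hne
  rw [hd]
  congr 1
  have hF : i % 2 ^ PiNat.firstDiff i.testBit j.testBit
      = j % 2 ^ PiNat.firstDiff i.testBit j.testBit :=
    (mod_two_pow_eq_iff i j _).2 fun m hm => PiNat.apply_eq_of_lt_firstDiff hm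
  have hF' := PiNat.apply_firstDiff_ne hne
  set F := PiNat.firstDiff i.testBit j.testBit
  apply le_antisymm
  · refine Nat.le_findGreatest ?_ hF
    by_contra hlt
    push Not at hlt
    apply h
    have hp : F < 2 ^ F := Nat.lt_two_pow_self
    rwa [Nat.mod_eq_of_lt (by omega), Nat.mod_eq_of_lt (by omega)] at hF
  · by_contra hlt
    push Not at hlt
    have hK : i % 2 ^ agreeLength i j = j % 2 ^ agreeLength i j :=
      Nat.findGreatest_spec (P := fun n => i % 2 ^ n = j % 2 ^ n) (Nat.zero_le _)
        (by simp [Nat.mod_one])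
    exact hF' ((mod_two_pow_eq_iff i j _).1 hK F hlt)

theorem cantor_denseRange : DenseRange (fun n m => Nat.testBit n m : ℕ → ℕ → Bool) := by
  intro x
  rw [Metric.mem_closure_range_iff]
  intro ε hε
  obtain ⟨n, hn⟩ := exists_pow_lt_of_lt_one hε (by norm_num : (1 / 2 : ℝ) < 1)
  have key : ∀ n, ∃ k : ℕ, ∀ m < n, k.testBit m = x m := by
    intro n
    refine ⟨Nat.ofBits (fun m : Fin n => x m), fun m hm => ?_⟩
    simp [Nat.testBit_ofBits_lt _ _ hm]
  obtain ⟨k, hk⟩ := key n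
  refine ⟨k, lt_of_le_of_lt ?_ hn⟩
  exact (PiNat.mem_cylinder_iff_dist_le (E := fun _ => Bool)).1 fun m hm => (hk m hm).symm

/-- The Cantor space as a computable metric space: the ideal points are the sequences that are
eventually `0`, the `n`-th one being the sequence of binary digits of `n`. -/
noncomputable instance cantorComputableMetricSpace : ComputableMetricSpace (ℕ → Bool) where
  ideal n := Nat.testBit n
  denseRange_ideal := cantor_denseRange
  dist_computable := by
    have hpow : Primrec₂ ((· ^ ·) : ℕ → ℕ → ℕ) := Primrec₂.unpaired'.1 Nat.Primrec.pow
    refine ⟨fun p _ => if p.1 = p.2 then Nat.pair 0 0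
      else Nat.pair (Nat.pair 1 0) (2 ^ agreeLength p.1 p.2 - 1), ?_, ?_⟩
    · refine Primrec.to_comp (Primrec.ite ?_ (Primrec.const _) ?_)
      · exact Primrec.eq.comp (Primrec.fst.comp Primrec.fst) (Primrec.snd.comp Primrec.fst)
      · exact Primrec₂.natPair.comp (Primrec.const _) (Primrec.nat_sub.comp
          (hpow.comp (Primrec.const 2) (agreeLength_primrec.comp
            (Primrec.fst.comp Primrec.fst) (Primrec.snd.comp Primrec.fst))) (Primrec.const 1))
    · rintro ⟨i, j⟩
      refine ⟨fun n => by simp, ?_⟩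
      by_cases h : i = j
      · subst h
        simp [ratNum]
      · have h1 : 1 ≤ 2 ^ agreeLength i j := Nat.one_le_two_pow
        simp [ratNum, h, cantor_dist_testBit i j h, Nat.cast_sub h1]

/-! ### Computable probability measures -/

section Measures

variable {X : Type*} [MeasurableSpace X]

/-- The measure `∑ (w + 1) δ_{s i}`, the sum being over the entries `(i, w)` of a list. -/
noncomputable def weightedSum (s : ℕ → X) (l : List (ℕ × ℕ)) : Measure X :=
  (l.map fun p => (((p.2 + 1 : ℕ) : ℝ≥0∞) • Measure.dirac (s p.1))).sum

theorem weightedSum_univ (s : ℕ → X) (l : List (ℕ × ℕ)) :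
    weightedSum s l Set.univ = (((l.map fun p => p.2 + 1).sum : ℕ) : ℝ≥0∞) := by
  induction l with
  | nil => simp [weightedSum]
  | cons p l ih =>
    have : weightedSum s (p :: l)
        = ((p.2 + 1 : ℕ) : ℝ≥0∞) • Measure.dirac (s p.1) + weightedSum s l := by
      simp [weightedSum]
    rw [this, Measure.add_apply, ih]
    simp

/-- The numbering of the ideal measures: the probability measures concentrated on finitely many ideal
points and giving them rational weights. An index is decoded as a non-empty list of pairs `(i, w)`,
where `(w + 1) / (sum of all the w + 1)` is the mass put at the `i`-th ideal point. -/
noncomputable def idealMeasure (s : ℕ → X) (n : ℕ) : ProbabilityMeasure X :=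
  let c := Denumerable.ofNat ((ℕ × ℕ) × List (ℕ × ℕ)) n
  ⟨(weightedSum s (c.1 :: c.2) Set.univ)⁻¹ • weightedSum s (c.1 :: c.2), ⟨by
    rw [Measure.smul_apply, smul_eq_mul, weightedSum_univ]
    refine ENNReal.inv_mul_cancel ?_ (ENNReal.natCast_ne_top _)
    rw [List.map_cons, List.sum_cons, Nat.cast_ne_zero]
    omega⟩⟩

/-- A Borel probability measure is computable if it is a constructive point of the space of Borel
probability measures with the Prokhorov metric and the ideal measures. -/
def IsComputableMeasure [MetricSpace X] [ComputableMetricSpace X] [BorelSpace X]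
    (μ : ProbabilityMeasure X) : Prop :=
  ConstructivePoint
    (fun n => LevyProkhorov.ofMeasure (idealMeasure (ComputableMetricSpace.ideal : ℕ → X) n))
    (LevyProkhorov.ofMeasure μ)

end Measures

/-! ### Morphisms and binary representations -/

section Morphisms

variable {X Y : Type*}
  [MetricSpace X] [ComputableMetricSpace X] [MeasurableSpace X] [BorelSpace X]
  [MetricSpace Y] [ComputableMetricSpace Y] [MeasurableSpace Y] [BorelSpace Y]

/-- A morphism `(X, μ) → (Y, ν)` of computable probability spaces: a computable measure-preserving
function defined on a `Π⁰₂` set of full measure. -/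
structure Morphism (μ : ProbabilityMeasure X) (ν : ProbabilityMeasure Y) where
  /-- The domain of the morphism. -/
  dom : Set X
  /-- The underlying function. -/
  toFun : dom → Y
  isPiZeroTwo_dom : IsPiZeroTwo dom
  measure_dom : (μ : Measure X) dom = 1
  computable : ComputableOn toFun
  measure_preimage : ∀ A : Set Y, MeasurableSet A →
    (ν : Measure Y) A = (μ : Measure X) {x | ∃ h : x ∈ dom, toFun ⟨x, h⟩ ∈ A}

/-- An isomorphism of computable probability spaces: a pair of morphisms `F`, `G` with
`G ∘ F = id` on `F⁻¹ (dom G)` and `F ∘ G = id` on `G⁻¹ (dom F)`. -/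
structure Isomorphism (μ : ProbabilityMeasure X) (ν : ProbabilityMeasure Y) where
  /-- The morphism from the first space to the second. -/
  hom : Morphism μ ν
  /-- The morphism from the second space to the first. -/
  inv : Morphism ν μ
  inv_hom : ∀ (x : hom.dom) (h : hom.toFun x ∈ inv.dom), inv.toFun ⟨hom.toFun x, h⟩ = (x : X)
  hom_inv : ∀ (y : inv.dom) (h : inv.toFun y ∈ hom.dom), hom.toFun ⟨inv.toFun y, h⟩ = (y : Y)

/-- The preimages of a point under a morphism. -/
def Morphism.fiber {μ : ProbabilityMeasure X} {ν : ProbabilityMeasure Y} (F : Morphism μ ν) (y : Y) :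
    Set X :=
  {x | ∃ h : x ∈ F.dom, F.toFun ⟨x, h⟩ = y}

/-- A binary representation of `(X, μ)`. The expansions of a point `x` are the elements of
`toMorphism.fiber x`. -/
structure BinaryRepresentation (μ : ProbabilityMeasure X) where
  /-- The measure on the Cantor space. -/
  measure : ProbabilityMeasure (ℕ → Bool)
  isComputableMeasure : IsComputableMeasure measure
  /-- The decoding morphism. -/
  toMorphism : Morphism measure μ
  surjective : Function.Surjective toMorphism.toFun
  /-- The set of points on which the inverse is defined. -/
  D : Set X
  dense_D : Dense D
  measure_D : (μ : Measure X) D = 1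
  isPiZeroTwo_D : IsPiZeroTwo D
  /-- The inverse, mapping a point of `D` to its unique expansion. -/
  inverse : D → (ℕ → Bool)
  fiber_eq : ∀ x : D, toMorphism.fiber (x : X) = {inverse x}
  computable_inverse : ComputableOn inverse

end Morphisms

end ComputableProbability

open ComputableProbability

/-! For `n = ⟨i, k⟩` call `2 ^ k * dist x (s i)` the level `n` of `x`. The reals `α ∈ [1, 2]` such
that some ideal point has a level equal to `α`, or such that `μ` charges a sphere `{level n = α}`,
are countably many. They can be avoided effectively: nested dyadic intervals `I t` are chosen so
that the `t`-th one keeps away from the first levels of the first ideal points and so that the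
shells `{level n ∈ I t}`, `n ≤ t`, are seen to have small measure by looking at the finitely
supported measures that converge to `μ`. Their common point is a threshold `α`.

The `n`-th binary digit of `x` says whether the level `n` of `x` is below `α`, that is, whether `x`
lies in the ball of center `s i` and radius `α / 2 ^ k`. These digits are computable away from the
null spheres, and their distribution is a computable measure because the spheres are uniformly null.
A sequence with a digit `1` at each scale `k`, all of whose prefixes begin the expansions of ideal
points, describes balls that shrink to a point and so decodes it. Every point is decoded from some
sequence, as a limit of expansions of ideal points, but a point on no sphere is decoded only from
its own expansion. -/

namespace ComputableProbability

/-! ### Closure properties of computable functions -/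

section Recursion

attribute [fun_prop] Computable Computable.const Computable.comp Computable.pair

variable {α β γ : Type*} [Primcodable α] [Primcodable β] [Primcodable γ]

@[fun_prop]
theorem computable_id : Computable fun a : α => a := Computable.id

@[fun_prop]
theorem computable_fst {f : α → β × γ} (hf : Computable f) : Computable fun a => (f a).1 :=
  Computable.fst.comp hf

@[fun_prop]
theorem computable_snd {f : α → β × γ} (hf : Computable f) : Computable fun a => (f a).2 :=
  Computable.snd.comp hf

@[fun_prop]
theorem computable_add {f g : α → ℕ} (hf : Computable f) (hg : Computable g) :
    Computable fun a => f a + g a := Primrec.nat_add.to_comp.comp hf hg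

@[fun_prop]
theorem computable_sub {f g : α → ℕ} (hf : Computable f) (hg : Computable g) :
    Computable fun a => f a - g a := Primrec.nat_sub.to_comp.comp hf hg

@[fun_prop]
theorem computable_mul {f g : α → ℕ} (hf : Computable f) (hg : Computable g) :
    Computable fun a => f a * g a := Primrec.nat_mul.to_comp.comp hf hg

@[fun_prop]
theorem computable_div {f g : α → ℕ} (hf : Computable f) (hg : Computable g) :
    Computable fun a => f a / g a := Primrec.nat_div.to_comp.comp hf hg

@[fun_prop]
theorem computable_pow {f g : α → ℕ} (hf : Computable f) (hg : Computable g) :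
    Computable fun a => f a ^ g a :=
  (Primrec₂.unpaired'.1 Nat.Primrec.pow).to_comp.comp hf hg

@[fun_prop]
theorem computable_natPair {f g : α → ℕ} (hf : Computable f) (hg : Computable g) :
    Computable fun a => Nat.pair (f a) (g a) := Primrec₂.natPair.to_comp.comp hf hg

@[fun_prop]
theorem computable_unpair {f : α → ℕ} (hf : Computable f) :
    Computable fun a => (f a).unpair := Computable.unpair.comp hf

@[fun_prop]
theorem computable_decide_lt {f g : α → ℕ} (hf : Computable f) (hg : Computable g) :
    Computable fun a => decide (f a < g a) :=
  (PrimrecRel.decide Primrec.nat_lt).to_comp.comp hf hg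

@[fun_prop]
theorem computable_decide_le {f g : α → ℕ} (hf : Computable f) (hg : Computable g) :
    Computable fun a => decide (f a ≤ g a) :=
  (PrimrecRel.decide Primrec.nat_le).to_comp.comp hf hg

@[fun_prop]
theorem computable_decide_eq {f g : α → ℕ} (hf : Computable f) (hg : Computable g) :
    Computable fun a => decide (f a = g a) :=
  (PrimrecRel.decide (Primrec.eq (α := ℕ))).to_comp.comp hf hg

@[fun_prop]
theorem computable_and {f g : α → Bool} (hf : Computable f) (hg : Computable g) :
    Computable fun a => f a && g a := Primrec.and.to_comp.comp hf hg

@[fun_prop]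
theorem computable_or {f g : α → Bool} (hf : Computable f) (hg : Computable g) :
    Computable fun a => f a || g a := Primrec.or.to_comp.comp hf hg

@[fun_prop]
theorem computable_not {f : α → Bool} (hf : Computable f) :
    Computable fun a => !f a := Primrec.not.to_comp.comp hf

@[fun_prop]
theorem computable_cond {c : α → Bool} {f g : α → β} (hc : Computable c) (hf : Computable f)
    (hg : Computable g) : Computable fun a => bif c a then f a else g a :=
  Computable.cond hc hf hg

@[fun_prop]
theorem computable_testBit {f g : α → ℕ} (hf : Computable f) (hg : Computable g) :
    Computable fun a => (f a).testBit (g a) := by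
  have : Computable fun a => decide (f a / 2 ^ g a % 2 = 1) :=
    computable_decide_eq (Primrec.nat_mod.to_comp.comp
      (computable_div hf (computable_pow (.const 2) hg)) (.const 2)) (.const 1)
  exact this.of_eq fun a => Nat.testBit_eq_decide_div_mod_eq.symm

@[fun_prop]
theorem computable_some {f : α → β} (hf : Computable f) : Computable fun a => some (f a) :=
  Computable.option_some.comp hf

@[fun_prop]
theorem computable_option_map {f : α → Option β} {g : α → β → γ} (hf : Computable f)
    (hg : Computable fun p : α × β => g p.1 p.2) : Computable fun a => (f a).map (g a) :=
  Computable.option_map hf hg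

@[fun_prop]
theorem computable_option_bind {f : α → Option β} {g : α → β → Option γ} (hf : Computable f)
    (hg : Computable fun p : α × β => g p.1 p.2) : Computable fun a => (f a).bind (g a) :=
  Computable.option_bind hf hg

@[fun_prop]
theorem computable_option_getD {f : α → Option β} {g : α → β} (hf : Computable f)
    (hg : Computable g) : Computable fun a => (f a).getD (g a) :=
  Computable.option_getD hf hg

@[fun_prop]
theorem computable_cons {f : α → β} {g : α → List β} (hf : Computable f) (hg : Computable g) :
    Computable fun a => f a :: g a := Computable.list_cons.comp hf hg

@[fun_prop]
theorem computable_append {f g : α → List β} (hf : Computable f) (hg : Computable g) :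
    Computable fun a => f a ++ g a := Computable.list_append.comp hf hg

@[fun_prop]
theorem computable_length {f : α → List β} (hf : Computable f) :
    Computable fun a => (f a).length := Computable.list_length.comp hf

@[fun_prop]
theorem computable_range {f : α → ℕ} (hf : Computable f) :
    Computable fun a => List.range (f a) := Primrec.list_range.to_comp.comp hf

@[fun_prop]
theorem computable_getElem? {f : α → List β} {g : α → ℕ} (hf : Computable f)
    (hg : Computable g) : Computable fun a => (f a)[g a]? := Computable.list_getElem?.comp hf hg

@[fun_prop]
theorem computable_nat_rec {f : α → ℕ} {g : α → β} {h : α → ℕ → β → β} (hf : Computable f)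
    (hg : Computable g) (hh : Computable fun p : α × ℕ × β => h p.1 p.2.1 p.2.2) :
    Computable fun a => (Nat.rec (g a) (h a) (f a) : β) :=
  Computable.nat_rec (h := fun a p => h a p.1 p.2) hf hg hh

@[fun_prop]
theorem computable_foldl {f : α → List β} {g : α → γ} {h : α → γ → β → γ} (hf : Computable f)
    (hg : Computable g) (hh : Computable fun p : α × γ × β => h p.1 p.2.1 p.2.2) :
    Computable fun a => (f a).foldl (h a) (g a) := by
  have hrec : Computable fun a =>
      (Nat.rec (g a) (fun i c => ((f a)[i]?.map (h a c)).getD c) (f a).length : γ) := by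
    fun_prop
  refine hrec.of_eq fun a => ?_
  have foldl_take : ∀ n ≤ (f a).length,
      (Nat.rec (g a) (fun i c => ((f a)[i]?.map (h a c)).getD c) n : γ)
        = ((f a).take n).foldl (h a) (g a) := by
    intro n
    induction n with
    | zero => simp
    | succ n ih =>
      intro hn
      simp only [ih (Nat.le_of_succ_le hn), List.take_add_one, List.foldl_append]
      simp [Nat.lt_of_succ_le hn]
  simpa using foldl_take _ le_rfl

@[fun_prop]
theorem computable_map {f : α → List β} {g : α → β → γ} (hf : Computable f)
    (hg : Computable fun p : α × β => g p.1 p.2) : Computable fun a => (f a).map (g a) := by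
  have hfold : Computable fun a => (f a).foldl (fun c b => c ++ [g a b]) [] := by fun_prop
  exact hfold.of_eq fun a => by
    rw [List.foldl_append_eq_append, List.nil_append, ← List.flatMap_def, ← List.map_eq_flatMap]

@[fun_prop]
theorem computable_sum {f : α → List ℕ} (hf : Computable f) : Computable fun a => (f a).sum := by
  simp only [List.sum_eq_foldl]
  fun_prop

@[fun_prop]
theorem computable_all {f : α → List β} {p : α → β → Bool} (hf : Computable f)
    (hp : Computable fun q : α × β => p q.1 q.2) : Computable fun a => (f a).all (p a) := by
  have hfold : Computable fun a => (f a).foldl (fun c b => c && p a b) true := by fun_prop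
  refine hfold.of_eq fun a => ?_
  have foldl_and : ∀ (l : List β) c, l.foldl (fun c b => c && p a b) c = (c && l.all (p a)) := by
    intro l
    induction l with
    | nil => simp
    | cons b l ih => simp [ih, Bool.and_assoc]
  rw [foldl_and, Bool.true_and]

theorem computable_ofBits {p : α → ℕ → Bool} {n : α → ℕ}
    (hp : Computable fun q : α × ℕ => p q.1 q.2) (hn : Computable n) :
    Computable fun a => Nat.ofBits fun i : Fin (n a) => p a i := by
  have horner : Computable fun a => (List.range (n a)).reverse.foldl
      (fun c i => 2 * c + bif p a i then 1 else 0) 0 := by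
    have := Primrec.to_comp (Primrec.list_reverse (α := ℕ))
    fun_prop
  refine horner.of_eq fun a => ?_
  rw [List.foldl_reverse, ← List.map_coe_finRange_eq_range, List.foldr_map, Nat.ofBits,
    Fin.foldr_eq_foldr_finRange]
  rfl

theorem exists_computable_choice {P : α → ℕ → Bool} (hP : Computable fun q : α × ℕ => P q.1 q.2)
    (h : ∀ a, ∃ n, P a n = true) : ∃ f : α → ℕ, Computable f ∧ ∀ a, P a (f a) = true := by
  refine ⟨fun a => Nat.find (h a), ?_, fun a => Nat.find_spec (h a)⟩
  refine Partrec.of_eq_tot (Partrec.rfind (p := fun a n => Part.some (P a n))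
    (Computable₂.partrec₂ hP)) fun a => ?_
  refine Nat.mem_rfind.2 ⟨?_, fun {m} hm => ?_⟩
  · simpa using (Nat.find_spec (h a)).symm
  · simpa using Nat.find_min (h a) hm

theorem rePred_exists {P : α → ℕ → Bool} (hP : Computable fun q : α × ℕ => P q.1 q.2) :
    REPred fun a => ∃ n, P a n = true := by
  refine (Partrec.rfind (p := fun a n => Part.some (P a n))
    (Computable₂.partrec₂ hP)).dom_re.of_eq fun a => ?_
  refine Nat.rfind_dom.trans ⟨?_, ?_⟩
  · rintro ⟨n, hn, -⟩
    exact ⟨n, (Part.mem_some_iff.1 hn).symm⟩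
  · rintro ⟨n, hn⟩
    exact ⟨n, Part.mem_some_iff.2 hn.symm, fun _ => trivial⟩

end Recursion

/-! ### Recursive operators -/

section Operators

theorem length_initSeg (σ : ℕ → ℕ) (n : ℕ) : (initSeg σ n).length = n := by simp [initSeg]

theorem getElem?_initSeg (σ : ℕ → ℕ) {n m : ℕ} (h : m < n) : (initSeg σ n)[m]? = some (σ m) := by
  simp [initSeg, h]

theorem initSeg_succ (σ : ℕ → ℕ) (n : ℕ) : initSeg σ (n + 1) = initSeg σ n ++ [σ n] := by
  simp [initSeg, List.range_succ]

theorem initSeg_congr {σ τ : ℕ → ℕ} {n : ℕ} (h : ∀ m < n, σ m = τ m) :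
    initSeg σ n = initSeg τ n :=
  List.map_congr_left fun m hm => h m (List.mem_range.1 hm)

theorem initSeg_prefix_of_le (σ : ℕ → ℕ) {n m : ℕ} (h : m ≤ n) : initSeg σ m <+: initSeg σ n := by
  induction n, h using Nat.le_induction with
  | base => exact List.prefix_rfl
  | succ n _ ih => exact ih.trans (by rw [initSeg_succ]; exact List.prefix_append _ _)

theorem initSeg_prefix_iff {σ : ℕ → ℕ} {n : ℕ} {l : List ℕ} :
    initSeg σ n <+: l ↔ ∀ m < n, l[m]? = some (σ m) := by
  simp [List.prefix_iff_getElem?, initSeg]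

/-- The operator induced by a map on finite sequences: its value at `σ` is a limit of the values of
the map on the prefixes of `σ`. -/
noncomputable def limitOperator (F' : List ℕ → List ℕ) : (ℕ → ℕ) →. (ℕ → ℕ) := fun σ =>
  ⟨∃ τ, ∀ n, ∃ k, initSeg τ n <+: F' (initSeg σ k), fun h => h.choose⟩

theorem recursiveOperator_limitOperator {F' : List ℕ → List ℕ} (hF' : Computable F')
    (hmono : ∀ u v, u <+: v → F' u <+: F' v) : RecursiveOperator (limitOperator F') := by
  refine ⟨F', hF', hmono, ?_⟩
  rintro σ τ ⟨h, rfl⟩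
  exact h.choose_spec

theorem RecursiveOperator.exists_modulus {F : (ℕ → ℕ) →. (ℕ → ℕ)} (hF : RecursiveOperator F)
    {σ τ : ℕ → ℕ} (hτ : τ ∈ F σ) (n : ℕ) :
    ∃ k, ∀ σ' τ', τ' ∈ F σ' → (∀ m < k, σ' m = σ m) → τ' n = τ n := by
  obtain ⟨F', -, hmono, hlim⟩ := hF
  obtain ⟨k, hk⟩ := hlim σ τ hτ (n + 1)
  refine ⟨k, fun σ' τ' hτ' hσ' => ?_⟩
  obtain ⟨k', hk'⟩ := hlim σ' τ' hτ' (n + 1)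
  rw [← initSeg_congr hσ'] at hk
  have hk := hk.trans (hmono _ _ (initSeg_prefix_of_le σ' (le_max_left k k')))
  have hk' := hk'.trans (hmono _ _ (initSeg_prefix_of_le σ' (le_max_right k k')))
  exact Option.some_injective _ ((initSeg_prefix_iff.1 hk' n n.lt_succ_self).symm.trans
    (initSeg_prefix_iff.1 hk n n.lt_succ_self))

/-- The state after reading `u`: the word read so far, and the word written so far. Each time a
letter is read, `c m v` may supply the next letter to be written, where `m` is the number of letters
already written and `v` is the word read. -/
def emitState (c : ℕ → List ℕ → Option ℕ) (u : List ℕ) : List ℕ × List ℕ :=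
  u.foldl (fun w a => (w.1 ++ [a], w.2 ++ ((c w.2.length (w.1 ++ [a])).map fun b => [b]).getD []))
    ([], [])

/-- The map on finite sequences that writes the letters supplied by `c`, in the sense of
`emitState`. -/
def emit (c : ℕ → List ℕ → Option ℕ) (u : List ℕ) : List ℕ := (emitState c u).2

variable {c : ℕ → List ℕ → Option ℕ}

theorem computable_emit (hc : Computable fun p : ℕ × List ℕ => c p.1 p.2) :
    Computable (emit c) := by
  unfold emit emitState
  fun_prop

theorem emitState_fst (u : List ℕ) : (emitState c u).1 = u := by
  induction u using List.reverseRecOn with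
  | nil => rfl
  | append_singleton u a ih => rw [emitState, List.foldl_concat, ← emitState, ih]

theorem emit_concat (u : List ℕ) (a : ℕ) :
    emit c (u ++ [a])
      = emit c u ++ ((c (emit c u).length (u ++ [a])).map fun b => [b]).getD [] := by
  rw [emit, emitState, List.foldl_concat, ← emitState, emitState_fst]
  rfl

theorem emit_prefix {u v : List ℕ} (h : u <+: v) : emit c u <+: emit c v := by
  obtain ⟨t, rfl⟩ := h
  induction t using List.reverseRecOn with
  | nil => rw [List.append_nil]
  | append_singleton t a ih =>
    rw [← List.append_assoc, emit_concat]
    exact ih.trans (List.prefix_append _ _)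

variable {σ : ℕ → ℕ}

theorem exists_eq_of_getElem?_emit {k m a : ℕ} (h : (emit c (initSeg σ k))[m]? = some a) :
    ∃ j, c m (initSeg σ j) = some a := by
  induction k with
  | zero => simp [initSeg, emit, emitState] at h
  | succ k ih =>
    rw [initSeg_succ, emit_concat, ← initSeg_succ] at h
    cases hc : c (emit c (initSeg σ k)).length (initSeg σ (k + 1)) with
    | none => exact ih (by simpa [hc] using h)
    | some b =>
      rw [hc, Option.map_some, Option.getD_some, List.getElem?_append] at h
      split_ifs at h with hm
      · exact ih h
      · obtain ⟨h0, hb⟩ := List.getElem?_eq_some_iff.1 h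
        have hm : m = (emit c (initSeg σ k)).length := by simp at h0; omega
        subst hm
        exact ⟨k + 1, by simpa [← hb] using hc⟩

theorem exists_le_length_emit (h : ∀ m, ∃ᶠ k in atTop, (c m (initSeg σ k)).isSome) (n : ℕ) :
    ∃ k, n ≤ (emit c (initSeg σ k)).length := by
  induction n with
  | zero => exact ⟨0, Nat.zero_le _⟩
  | succ n ih =>
    obtain ⟨k, hk⟩ := ih
    obtain ⟨k', hkk', hk'⟩ := frequently_atTop.1 (h n) (k + 1)
    obtain ⟨j, rfl⟩ : ∃ j, k' = j + 1 := ⟨k' - 1, by omega⟩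
    have hj : n ≤ (emit c (initSeg σ j)).length :=
      hk.trans (emit_prefix (initSeg_prefix_of_le σ (by omega))).length_le
    rcases hj.lt_or_eq with hlt | rfl
    · exact ⟨j, hlt⟩
    · obtain ⟨a, ha⟩ := Option.isSome_iff_exists.1 hk'
      refine ⟨j + 1, ?_⟩
      rw [initSeg_succ, emit_concat, ← initSeg_succ, ha]
      simp

theorem exists_mem_limitOperator_emit (h : ∀ m, ∃ᶠ k in atTop, (c m (initSeg σ k)).isSome) :
    ∃ τ ∈ limitOperator (emit c) σ, ∀ m, ∃ k, c m (initSeg σ k) = some (τ m) := by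
  have hdom : ∃ τ, ∀ n, ∃ k, initSeg τ n <+: emit c (initSeg σ k) := by
    choose k hk using exists_le_length_emit h
    have hget : ∀ m, ∃ a, (emit c (initSeg σ (k (m + 1))))[m]? = some a := fun m =>
      ⟨_, List.getElem?_eq_getElem (hk (m + 1))⟩
    choose τ hτ using hget
    refine ⟨τ, fun n => ⟨(Finset.range (n + 1)).sup k, initSeg_prefix_iff.2 fun m hm => ?_⟩⟩
    have hle : k (m + 1) ≤ (Finset.range (n + 1)).sup k :=
      Finset.le_sup (Finset.mem_range.2 (by omega))
    obtain ⟨t, ht⟩ := emit_prefix (c := c) (initSeg_prefix_of_le σ hle)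
    rw [← ht, List.getElem?_append_left (hk (m + 1)), hτ m]
  refine ⟨hdom.choose, ⟨hdom, rfl⟩, fun m => ?_⟩
  obtain ⟨k, hk⟩ := hdom.choose_spec (m + 1)
  exact exists_eq_of_getElem?_emit (initSeg_prefix_iff.1 hk m m.lt_succ_self)

end Operators

/-! ### Names and computable functions -/

section Names

variable {X : Type*} [PseudoMetricSpace X] {s : ℕ → X} {σ : ℕ → ℕ} {x : X}

theorem CauchyName.dist_le (h : CauchyName s σ x) (n : ℕ) : dist (s (σ n)) x ≤ 2 / 2 ^ n := by
  refine dist_le_of_le_geometric_two_of_tendsto (f := fun n => s (σ n)) (fun k => ?_) h.2 n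
  refine (h.1 k).le.trans_eq ?_
  rw [div_self two_ne_zero, one_div_pow]

theorem CauchyName.dist_lt (h : CauchyName s σ x) (n : ℕ) : dist (s (σ n)) x < 4 / 2 ^ n :=
  (h.dist_le n).trans_lt (by gcongr; norm_num)

theorem cauchyName_of_dist_le (h : ∀ n, dist (s (σ n)) x ≤ (1 / 2) ^ (n + 1)) :
    CauchyName s σ x := by
  refine ⟨fun n => ?_, ?_⟩
  · have hpos : (0 : ℝ) < (1 / 2) ^ n := by positivity
    calc dist (s (σ n)) (s (σ (n + 1)))
        ≤ dist (s (σ n)) x + dist (s (σ (n + 1))) x := dist_triangle_right _ _ _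
      _ ≤ (1 / 2) ^ (n + 1) + (1 / 2) ^ (n + 1 + 1) := add_le_add (h n) (h (n + 1))
      _ < (1 / 2) ^ n := by rw [pow_succ, pow_succ, pow_succ]; linarith
  · rw [tendsto_iff_dist_tendsto_zero]
    refine squeeze_zero (fun _ => dist_nonneg) h ?_
    exact (tendsto_pow_atTop_nhds_zero_of_lt_one (by norm_num) (by norm_num)).comp
      (tendsto_add_atTop_nat 1)

theorem constructivePoint_of_dist_le (hσ : Computable σ) (c : ℕ)
    (h : ∀ n, dist (s (σ n)) x ≤ 2 ^ c * (1 / 2) ^ n) : ConstructivePoint s x := by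
  refine ⟨fun n => σ (n + 1 + c), by fun_prop, cauchyName_of_dist_le fun n => (h _).trans_eq ?_⟩
  rw [pow_add (1 / 2 : ℝ) (n + 1) c, mul_comm, mul_assoc, ← mul_pow]
  norm_num

theorem exists_cauchyName_extending (hs : DenseRange s) (x : X) :
    ∃ σ, CauchyName s σ x ∧ ∀ k, ∀ᶠ y in 𝓝 x, ∃ σ', CauchyName s σ' y ∧ ∀ m < k, σ' m = σ m := by
  have happrox : ∀ (y : X) (n : ℕ), ∃ j, dist y (s j) < (1 / 2) ^ (n + 2) := fun y n =>
    Metric.denseRange_iff.1 hs y _ (by positivity)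
  choose name hname using happrox
  have hpow : ∀ m, (1 / 2 : ℝ) ^ (m + 2) + (1 / 2) ^ (m + 2) = (1 / 2) ^ (m + 1) := by
    intro m; ring
  have hdist : ∀ y m, dist (s (name y m)) y ≤ (1 / 2) ^ (m + 1) := by
    intro y m
    have hpos : (0 : ℝ) < (1 / 2) ^ (m + 2) := by positivity
    linarith [hname y m, hpow m, dist_comm y (s (name y m))]
  refine ⟨name x, cauchyName_of_dist_le (hdist x), fun k => ?_⟩
  filter_upwards [Metric.ball_mem_nhds x (show (0 : ℝ) < (1 / 2) ^ (k + 2) by positivity)] with y hy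
  refine ⟨fun m => if m < k then name x m else name y m, cauchyName_of_dist_le fun m => ?_,
    fun m hm => if_pos hm⟩
  split_ifs with hm
  · have hkm : (1 / 2 : ℝ) ^ (k + 2) ≤ (1 / 2) ^ (m + 2) :=
      pow_le_pow_of_le_one (by norm_num) (by norm_num) (by omega)
    calc dist (s (name x m)) y ≤ dist x (s (name x m)) + dist y x := by
          rw [dist_comm x, dist_comm y]; exact dist_triangle _ _ _
      _ ≤ (1 / 2) ^ (m + 2) + (1 / 2) ^ (m + 2) :=
        add_le_add (hname x m).le ((Metric.mem_ball.1 hy).le.trans hkm)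
      _ = (1 / 2) ^ (m + 1) := hpow m
  · exact hdist y m

end Names

section ComputableFunctions

variable {X Y : Type*} [MetricSpace X] [ComputableMetricSpace X]
  [MetricSpace Y] [ComputableMetricSpace Y] {D : Set X} {f : D → Y}

theorem ComputableOn.continuous (hf : ComputableOn f) : Continuous f := by
  obtain ⟨F, hF, hname⟩ := hf
  rw [Metric.continuous_iff']
  intro x ε hε
  obtain ⟨σ, hσ, hext⟩ := exists_cauchyName_extending ComputableMetricSpace.denseRange_ideal (x : X)
  obtain ⟨τ, hτ, hτx⟩ := hname x σ hσ
  obtain ⟨n, hn⟩ := exists_pow_lt_of_lt_one (by positivity : 0 < ε / 4)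
    (by norm_num : (1 / 2 : ℝ) < 1)
  obtain ⟨k, hk⟩ := hF.exists_modulus hτ n
  filter_upwards [continuousAt_subtype_val.eventually (hext k)] with y ⟨σ', hσ', hagree⟩
  obtain ⟨τ', hτ', hτy⟩ := hname y σ' hσ'
  have hy := hτy.dist_le n
  rw [hk σ' τ' hτ' hagree] at hy
  calc dist (f y) (f x) ≤ _ := dist_triangle_left _ _ (ComputableMetricSpace.ideal (τ n))
    _ ≤ 2 / 2 ^ n + 2 / 2 ^ n := add_le_add hy (hτx.dist_le n)
    _ = 4 * (1 / 2) ^ n := by rw [one_div_pow]; ring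
    _ < ε := by linarith

theorem computableOn_of_certificates {c : ℕ → List ℕ → Option ℕ}
    (hc : Computable fun p : ℕ × List ℕ => c p.1 p.2)
    (hdef : ∀ (x : D) (σ : ℕ → ℕ), CauchyName ComputableMetricSpace.ideal σ (x : X) →
      ∀ m, ∃ᶠ k in atTop, (c m (initSeg σ k)).isSome)
    (hdist : ∀ (x : D) (σ : ℕ → ℕ), CauchyName ComputableMetricSpace.ideal σ (x : X) →
      ∀ m k b, c m (initSeg σ k) = some b →
        dist (ComputableMetricSpace.ideal b) (f x) ≤ (1 / 2) ^ (m + 1)) :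
    ComputableOn f := by
  refine ⟨limitOperator (emit c),
    recursiveOperator_limitOperator (computable_emit hc) fun _ _ => emit_prefix, fun x σ hσ => ?_⟩
  obtain ⟨τ, hτ, hcert⟩ := exists_mem_limitOperator_emit (hdef x σ hσ)
  refine ⟨τ, hτ, cauchyName_of_dist_le fun m => ?_⟩
  obtain ⟨k, hk⟩ := hcert m
  exact hdist x σ hσ m k _ hk

theorem computableOn_of_queries {q : ℕ → ℕ} {g : ℕ → ℕ → ℕ → Option ℕ} (hq : Computable q)
    (hg : Computable fun p : ℕ × ℕ × ℕ => g p.1 p.2.1 p.2.2)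
    (hdef : ∀ (x : D) (σ : ℕ → ℕ), CauchyName ComputableMetricSpace.ideal σ (x : X) →
      ∀ m, ∃ l, (g m l (σ (q l))).isSome)
    (hdist : ∀ (x : D) (σ : ℕ → ℕ), CauchyName ComputableMetricSpace.ideal σ (x : X) →
      ∀ m l b, g m l (σ (q l)) = some b →
        dist (ComputableMetricSpace.ideal b) (f x) ≤ (1 / 2) ^ (m + 1)) :
    ComputableOn f := by
  -- The prefix of length `⟨l, r⟩` makes the query `q l`, so that every query is made repeatedly.
  refine computableOn_of_certificates
    (c := fun m u => u[q u.length.unpair.1]?.bind (g m u.length.unpair.1)) (by fun_prop)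
    (fun x σ hσ m => ?_) fun x σ hσ m k b hb => ?_
  · obtain ⟨l, hl⟩ := hdef x σ hσ m
    refine frequently_atTop.2 fun r => ⟨Nat.pair l (r + q l + 1), ?_, ?_⟩
    · exact (by omega : r ≤ r + q l + 1).trans (Nat.right_le_pair _ _)
    · have hlt : q l < Nat.pair l (r + q l + 1) :=
        (by omega : q l < r + q l + 1).trans_le (Nat.right_le_pair _ _)
      simpa [length_initSeg, getElem?_initSeg σ hlt] using hl
  · rw [length_initSeg] at hb
    obtain ⟨a, ha, hga⟩ := Option.bind_eq_some_iff.1 hb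
    obtain ⟨_, rfl⟩ : q k.unpair.1 < k ∧ σ (q k.unpair.1) = a := by
      simpa [initSeg, List.getElem?_eq_some_iff] using ha
    exact hdist x σ hσ m _ b hga

theorem isOpen_idealBall (n : ℕ) : IsOpen (idealBall X n) := Metric.isOpen_ball

theorem UniformlyREOpen.isOpen {U : ℕ → Set X} (hU : UniformlyREOpen U) (n : ℕ) : IsOpen (U n) := by
  obtain ⟨E, -, h⟩ := hU
  rw [h n]
  exact isOpen_biUnion fun i _ => isOpen_idealBall i

theorem IsPiZeroTwo.measurableSet [MeasurableSpace X] [OpensMeasurableSpace X] {A : Set X}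
    (hA : IsPiZeroTwo A) : MeasurableSet A := by
  obtain ⟨U, hU, rfl⟩ := hA
  exact MeasurableSet.iInter fun n => (hU.isOpen n).measurableSet

theorem uniformlyREOpen_of_computable {U : ℕ → Set X} {P : ℕ → ℕ → Bool} {g : ℕ → ℕ → ℕ}
    (hP : Computable fun p : ℕ × ℕ => P p.1 p.2) (hg : Computable fun p : ℕ × ℕ => g p.1 p.2)
    (hU : ∀ n x, x ∈ U n ↔ ∃ t, P n t = true ∧ x ∈ idealBall X (g n t)) : UniformlyREOpen U := by
  refine ⟨_, rePred_exists (P := fun (p : ℕ × ℕ) t => P p.1 t && decide (g p.1 t = p.2))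
    (by fun_prop), fun n => ?_⟩
  ext x
  simp only [hU, Set.mem_ofPred_eq, Set.mem_iUnion, Bool.and_eq_true, decide_eq_true_eq,
    exists_prop]
  constructor
  · rintro ⟨t, ht, hx⟩
    exact ⟨_, ⟨t, ht, rfl⟩, hx⟩
  · rintro ⟨_, ⟨t, ht, rfl⟩, hx⟩
    exact ⟨t, ht, hx⟩

end ComputableFunctions

/-! ### Binary representations are isomorphisms -/

section Isomorphisms

theorem measurableSet_subtype_preimage {Y Z : Type*} [MeasurableSpace Y] [MeasurableSpace Z]
    {D : Set Y} {f : D → Z} (hD : MeasurableSet D) (hf : Measurable f) {A : Set Z}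
    (hA : MeasurableSet A) : MeasurableSet {x | ∃ h : x ∈ D, f ⟨x, h⟩ ∈ A} := by
  have himage : {x | ∃ h : x ∈ D, f ⟨x, h⟩ ∈ A} = Subtype.val '' (f ⁻¹' A) := by
    ext x
    simp
  rw [himage]
  exact hD.subtype_image (hf hA)

variable {X : Type*} [MetricSpace X] [ComputableMetricSpace X] [MeasurableSpace X]
  {μ : ProbabilityMeasure X}

namespace BinaryRepresentation

theorem exists_toFun_inverse (R : BinaryRepresentation μ) (x : R.D) :
    ∃ h : R.inverse x ∈ R.toMorphism.dom, R.toMorphism.toFun ⟨R.inverse x, h⟩ = x := by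
  change R.inverse x ∈ R.toMorphism.fiber (x : X)
  rw [R.fiber_eq]
  exact Set.mem_singleton _

theorem inverse_toFun (R : BinaryRepresentation μ) (ω : R.toMorphism.dom)
    (h : R.toMorphism.toFun ω ∈ R.D) : R.inverse ⟨R.toMorphism.toFun ω, h⟩ = ω := by
  have hω : (ω : ℕ → Bool) ∈ R.toMorphism.fiber (R.toMorphism.toFun ω) := ⟨ω.2, rfl⟩
  rw [R.fiber_eq ⟨_, h⟩] at hω
  exact hω.symm

variable [BorelSpace X]

theorem ae_toFun_mem (R : BinaryRepresentation μ) : ∀ᵐ ω ∂(R.measure : Measure (ℕ → Bool)),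
    ∃ h : ω ∈ R.toMorphism.dom, R.toMorphism.toFun ⟨ω, h⟩ ∈ R.D := by
  have hD := R.isPiZeroTwo_D.measurableSet
  have hpre := measurableSet_subtype_preimage R.toMorphism.isPiZeroTwo_dom.measurableSet
    R.toMorphism.computable.continuous.measurable hD
  refine (mem_ae_iff_prob_eq_one hpre).2 ?_
  rw [← R.toMorphism.measure_preimage _ hD, R.measure_D]

/-- The inverse of a binary representation, as a morphism. -/
def inverseMorphism (R : BinaryRepresentation μ) : Morphism μ R.measure where
  dom := R.D
  toFun := R.inverse
  isPiZeroTwo_dom := R.isPiZeroTwo_D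
  measure_dom := R.measure_D
  computable := R.computable_inverse
  measure_preimage A hA := by
    rw [R.toMorphism.measure_preimage _ (measurableSet_subtype_preimage
      R.isPiZeroTwo_D.measurableSet R.computable_inverse.continuous.measurable hA)]
    refine measure_congr ?_
    filter_upwards [R.ae_toFun_mem] with ω ⟨hω, hD⟩
    have hinv := R.inverse_toFun ⟨ω, hω⟩ hD
    refine propext ⟨fun hA => ⟨hω, hD, ?_⟩, fun ⟨_, _, hA⟩ => ?_⟩
    · rw [hinv]
      exact hA
    · rw [hinv] at hA
      exact hA

/-- A binary representation together with its inverse, as an isomorphism. -/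
def isomorphism (R : BinaryRepresentation μ) : Isomorphism R.measure μ where
  hom := R.toMorphism
  inv := R.inverseMorphism
  inv_hom := R.inverse_toFun
  hom_inv x _ := (R.exists_toFun_inverse x).2

end BinaryRepresentation

end Isomorphisms

/-! ### Levels and dyadic intervals -/

section Levels

variable {X : Type*} [MetricSpace X] [ComputableMetricSpace X]

/-- The distance to the `i`-th ideal point scaled by `2 ^ k`, where `n = ⟨i, k⟩`. Comparing it with
`1 ≤ α ≤ 2` decides membership in a ball of radius about `2 ^ (-k)` around that point. -/
noncomputable def level (n : ℕ) (x : X) : ℝ :=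
  2 ^ n.unpair.2 * dist (ComputableMetricSpace.ideal n.unpair.1) x

theorem abs_level_sub_le (n : ℕ) (x y : X) :
    |level n x - level n y| ≤ 2 ^ n.unpair.2 * dist x y := by
  rw [level, level, ← mul_sub, abs_mul, abs_of_pos (by positivity : (0 : ℝ) < 2 ^ n.unpair.2)]
  gcongr
  rw [dist_comm _ x, dist_comm _ y]
  exact abs_dist_sub_le _ _ _

theorem continuous_level (n : ℕ) : Continuous (level n : X → ℝ) :=
  continuous_const.mul (continuous_const.dist continuous_id)

@[fun_prop]
theorem computable_floor_two_pow_mul_ratNum {α : Type*} [Primcodable α] {f g : α → ℕ}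
    (hf : Computable f) (hg : Computable g) :
    Computable fun a => ⌊(2 : ℝ) ^ f a * (ratNum (g a) : ℝ)⌋₊ := by
  have hdiv : Computable fun a => (2 ^ f a * (g a).unpair.1.unpair.1
      - 2 ^ f a * (g a).unpair.1.unpair.2) / ((g a).unpair.2 + 1) := by fun_prop
  refine hdiv.of_eq fun a => ?_
  rw [← Nat.floor_natCast (R := ℝ) (2 ^ f a * (g a).unpair.1.unpair.1), ← Nat.floor_sub_natCast,
    ← Nat.floor_div_natCast, ratNum]
  push_cast
  ring_nf

theorem abs_floor_sub_le {y z : ℝ} (hz : 0 ≤ z) (h : |y - z| ≤ 1) : |(⌊y⌋₊ : ℝ) - z| ≤ 2 := by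
  have hlo := Nat.lt_floor_add_one y
  have hhi : (⌊y⌋₊ : ℝ) ≤ max y 0 := by
    rcases le_total 0 y with hy | hy
    · exact (Nat.floor_le hy).trans (le_max_left _ _)
    · simp [Nat.floor_of_nonpos hy]
  rw [abs_le] at h ⊢
  rcases le_max_iff.1 hhi with hhi | hhi <;> constructor <;> linarith

variable (X) in
/-- A computable family of natural numbers `val t n j` approximating `2 ^ t` times the `n`-th level
of the `j`-th ideal point. -/
structure LevelApproximation where
  /-- The approximations. -/
  val : ℕ → ℕ → ℕ → ℕ
  computable_val : Computable fun p : ℕ × ℕ × ℕ => val p.1 p.2.1 p.2.2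
  abs_val_sub_le (t n j : ℕ) :
    |(val t n j : ℝ) - 2 ^ t * level n (ComputableMetricSpace.ideal j : X)| ≤ 2

variable (X) in
theorem nonempty_levelApproximation : Nonempty (LevelApproximation X) := by
  obtain ⟨σ, hσ, hname⟩ := ComputableMetricSpace.dist_computable (X := X)
  have hσ : Computable fun p : (ℕ × ℕ) × ℕ => σ p.1 p.2 := hσ
  refine ⟨⟨fun t n j => ⌊(2 : ℝ) ^ (t + n.unpair.2)
    * (ratNum (σ (n.unpair.1, j) (t + n.unpair.2 + 1)) : ℝ)⌋₊, by fun_prop, fun t n j => ?_⟩⟩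
  rw [level, ← mul_assoc, ← pow_add]
  refine abs_floor_sub_le (by positivity) ?_
  have h := (hname (n.unpair.1, j)).dist_le (t + n.unpair.2 + 1)
  rw [Real.dist_eq] at h
  rw [← mul_sub, abs_mul, abs_of_pos (by positivity : (0 : ℝ) < 2 ^ (t + n.unpair.2))]
  calc _ ≤ (2 : ℝ) ^ (t + n.unpair.2) * (2 / 2 ^ (t + n.unpair.2 + 1)) := by gcongr
    _ = 1 := by rw [pow_succ]; field_simp

/-- `β` lies in the dyadic interval `[a / 2 ^ t, (a + 1) / 2 ^ t]`. -/
def MemDyadic (t a : ℕ) (β : ℝ) : Prop := (a : ℝ) ≤ 2 ^ t * β ∧ 2 ^ t * β ≤ a + 1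

namespace LevelApproximation

variable (A : LevelApproximation X) (t a n j : ℕ)

/-- The `n`-th level of the `j`-th ideal point appears to lie to the left of the dyadic interval
`[a / 2 ^ t, (a + 1) / 2 ^ t]`. -/
def below : Bool := decide (A.val t n j < a)

/-- The `n`-th level of the `j`-th ideal point is visibly away from the dyadic interval
`[a / 2 ^ t, (a + 1) / 2 ^ t]`. The margin exceeds the sum of `2` for the error of `val`, of `1` for
the length of the interval, and of `4 * 2 ^ n.unpair.2` for the variation of the level over the
distance `4 / 2 ^ t`, where `2 / 2 ^ t` is the accuracy of the `t`-th entry of a name. -/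
def far : Bool :=
  decide (a + 7 * 2 ^ n.unpair.2 < A.val t n j) || decide (A.val t n j + 7 * 2 ^ n.unpair.2 < a)

/-- All levels up to the `n`-th one are visibly away from the dyadic interval. -/
def separated : Bool := (List.range (n + 1)).all fun i => A.far t a i j

/-- The number whose first `n + 1` binary digits tell which levels appear to lie to the left of the
dyadic interval. -/
def digits : ℕ := Nat.ofBits fun i : Fin (n + 1) => A.below t a i j

variable {t a n j}

theorem separated_eq_true : A.separated t a n j = true ↔ ∀ i ≤ n, A.far t a i j = true := by
  simp [separated]

theorem testBit_digits {i : ℕ} (h : i ≤ n) :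
    (A.digits t a n j).testBit i = A.below t a i j :=
  Nat.testBit_ofBits_lt _ _ (Nat.lt_succ_of_le h)

section Computability

variable {α : Type*} [Primcodable α] {t a n j : α → ℕ}

@[fun_prop]
theorem computable_below (ht : Computable t) (ha : Computable a) (hn : Computable n)
    (hj : Computable j) : Computable fun x => A.below (t x) (a x) (n x) (j x) := by
  have := A.computable_val
  unfold below
  fun_prop

@[fun_prop]
theorem computable_far (ht : Computable t) (ha : Computable a) (hn : Computable n)
    (hj : Computable j) : Computable fun x => A.far (t x) (a x) (n x) (j x) := by
  have := A.computable_val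
  unfold far
  fun_prop

@[fun_prop]
theorem computable_separated (ht : Computable t) (ha : Computable a) (hn : Computable n)
    (hj : Computable j) : Computable fun x => A.separated (t x) (a x) (n x) (j x) := by
  unfold separated
  fun_prop

@[fun_prop]
theorem computable_digits (ht : Computable t) (ha : Computable a) (hn : Computable n)
    (hj : Computable j) : Computable fun x => A.digits (t x) (a x) (n x) (j x) :=
  computable_ofBits (p := fun x i => A.below (t x) (a x) i (j x)) (by fun_prop) (by fun_prop)

end Computability

variable {β : ℝ}

theorem abs_val_sub_two_pow_mul_level_le {x : X}
    (hx : dist (ComputableMetricSpace.ideal j) x ≤ 4 / 2 ^ t) :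
    |(A.val t n j : ℝ) - 2 ^ t * level n x| ≤ 2 + 4 * 2 ^ n.unpair.2 := by
  have hlevel : |2 ^ t * level n (ComputableMetricSpace.ideal j : X) - 2 ^ t * level n x|
      ≤ 4 * 2 ^ n.unpair.2 := by
    rw [← mul_sub, abs_mul, abs_of_pos (by positivity : (0 : ℝ) < 2 ^ t)]
    calc _ ≤ (2 : ℝ) ^ t * (2 ^ n.unpair.2 * (4 / 2 ^ t)) := by
          gcongr
          exact (abs_level_sub_le n _ _).trans (by gcongr)
      _ = 4 * 2 ^ n.unpair.2 := by field_simp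
  exact (abs_sub_le _ _ _).trans (add_le_add (A.abs_val_sub_le t n j) hlevel)

theorem level_ne_and_below_eq_of_far (hβ : MemDyadic t a β) (h : A.far t a n j = true) {x : X}
    (hx : dist (ComputableMetricSpace.ideal j) x ≤ 4 / 2 ^ t) :
    level n x ≠ β ∧ A.below t a n j = decide (level n x < β) := by
  obtain ⟨hlo, hhi⟩ := hβ
  have hval := abs_le.1 (A.abs_val_sub_two_pow_mul_level_le (n := n) hx)
  have hk : (1 : ℝ) ≤ 2 ^ n.unpair.2 := one_le_pow₀ one_le_two
  have ht : (0 : ℝ) < 2 ^ t := by positivity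
  rw [far, Bool.or_eq_true, decide_eq_true_eq, decide_eq_true_eq] at h
  rw [below]
  rcases h with h | h
  · have h' : (a : ℝ) + 7 * 2 ^ n.unpair.2 < A.val t n j := by exact_mod_cast h
    have hlt : β < level n x := lt_of_mul_lt_mul_left (by linarith) ht.le
    exact ⟨hlt.ne', by rw [decide_eq_false hlt.not_gt, decide_eq_false (by omega)]⟩
  · have h' : (A.val t n j : ℝ) + 7 * 2 ^ n.unpair.2 < a := by exact_mod_cast h
    have hlt : level n x < β := lt_of_mul_lt_mul_left (by linarith) ht.le
    exact ⟨hlt.ne, by rw [decide_eq_true hlt, decide_eq_true (by omega)]⟩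

theorem abs_level_sub_le_of_not_far (hβ : MemDyadic t a β) (h : A.far t a n j = false) {x : X}
    (hx : dist (ComputableMetricSpace.ideal j) x ≤ 4 / 2 ^ t) :
    |level n x - β| ≤ 14 * 2 ^ n.unpair.2 / 2 ^ t := by
  obtain ⟨hlo, hhi⟩ := hβ
  have hval := abs_le.1 (A.abs_val_sub_two_pow_mul_level_le (n := n) hx)
  have hk : (1 : ℝ) ≤ 2 ^ n.unpair.2 := one_le_pow₀ one_le_two
  have ht : (0 : ℝ) < 2 ^ t := by positivity
  rw [far, Bool.or_eq_false_iff, decide_eq_false_iff_not, decide_eq_false_iff_not, not_lt,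
    not_lt] at h
  have hup : (A.val t n j : ℝ) ≤ a + 7 * 2 ^ n.unpair.2 := by exact_mod_cast h.1
  have hdown : (a : ℝ) ≤ A.val t n j + 7 * 2 ^ n.unpair.2 := by exact_mod_cast h.2
  have hscale : 2 ^ t * |level n x - β| = |2 ^ t * level n x - 2 ^ t * β| := by
    rw [← mul_sub, abs_mul, abs_of_pos ht]
  rw [le_div_iff₀' ht, hscale, abs_le]
  constructor <;> linarith

theorem eventually_far {x : X} (hx : level n x ≠ β) : ∀ᶠ t : ℕ in atTop, ∀ a j, MemDyadic t a β →
    dist (ComputableMetricSpace.ideal j) x ≤ 4 / 2 ^ t → A.far t a n j = true := by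
  have hlim : Tendsto (fun t : ℕ => 14 * 2 ^ n.unpair.2 / (2 : ℝ) ^ t) atTop (𝓝 0) :=
    tendsto_const_nhds.div_atTop (tendsto_pow_atTop_atTop_of_one_lt one_lt_two)
  filter_upwards [hlim.eventually_lt_const (abs_pos.2 (sub_ne_zero.2 hx))] with t ht a j hβ hj
  by_contra hfar
  exact ht.not_ge (A.abs_level_sub_le_of_not_far hβ (Bool.eq_false_of_not_eq_true hfar) hj)

theorem eventually_separated {x : X} (hx : ∀ i ≤ n, level i x ≠ β) :
    ∀ᶠ t : ℕ in atTop, ∀ a j, MemDyadic t a β →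
      dist (ComputableMetricSpace.ideal j) x ≤ 4 / 2 ^ t → A.separated t a n j = true := by
  filter_upwards [(Set.finite_Iic n).eventually_all.2 fun i hi => A.eventually_far (hx i hi)]
    with t ht a j hβ hj
  exact A.separated_eq_true.2 fun i hi => ht i hi a j hβ hj

end LevelApproximation

end Levels

/-! ### Ideal measures -/

section IdealMeasures

/-- The pairs `(i, w)` listed by the index `n` of an ideal measure, which puts the mass
`(w + 1) / (sum of all the w + 1)` at the `i`-th ideal point. -/
def atoms (n : ℕ) : List (ℕ × ℕ) :=
  (Denumerable.ofNat ((ℕ × ℕ) × List (ℕ × ℕ)) n).1 ::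
    (Denumerable.ofNat ((ℕ × ℕ) × List (ℕ × ℕ)) n).2

/-- The total weight of the entries of a list of weighted atoms whose index satisfies `b`. -/
def weight (b : ℕ → Bool) (l : List (ℕ × ℕ)) : ℕ :=
  (l.map fun q => bif b q.1 then q.2 + 1 else 0).sum

/-- The distribution of the index of a random atom of the `n`-th ideal measure. -/
noncomputable def indexMeasure (n : ℕ) : ProbabilityMeasure ℕ := idealMeasure id n

/-- The index of the ideal measure obtained by replacing each index `i` of an atom by `d i`. -/
def reindex (d : ℕ → ℕ) (n : ℕ) : ℕ :=
  let c := Denumerable.ofNat ((ℕ × ℕ) × List (ℕ × ℕ)) n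
  Encodable.encode ((d c.1.1, c.1.2), c.2.map fun q => (d q.1, q.2))

section Computability

variable {α : Type*} [Primcodable α]

@[fun_prop]
theorem computable_ofNat {β : Type*} [Denumerable β] {f : α → ℕ} (hf : Computable f) :
    Computable fun a => Denumerable.ofNat β (f a) :=
  (Computable.ofNat β).comp hf

@[fun_prop]
theorem computable_atoms {f : α → ℕ} (hf : Computable f) : Computable fun a => atoms (f a) := by
  unfold atoms
  fun_prop

@[fun_prop]
theorem computable_weight {b : α → ℕ → Bool} {l : α → List (ℕ × ℕ)}
    (hb : Computable fun p : α × ℕ => b p.1 p.2) (hl : Computable l) :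
    Computable fun a => weight (b a) (l a) := by
  unfold weight
  fun_prop

@[fun_prop]
theorem computable_reindex {d : α → ℕ → ℕ} {f : α → ℕ}
    (hd : Computable fun p : α × ℕ => d p.1 p.2) (hf : Computable f) :
    Computable fun a => reindex (d a) (f a) := by
  unfold reindex
  exact Computable.encode.comp (by fun_prop)

end Computability

theorem weight_true_atoms_pos (n : ℕ) : 0 < weight (fun _ => true) (atoms n) := by
  simp [weight, atoms]

theorem atoms_reindex (d : ℕ → ℕ) (n : ℕ) :
    atoms (reindex d n) = (atoms n).map fun q => (d q.1, q.2) := by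
  simp only [atoms, reindex, Denumerable.ofNat_encode, List.map_cons]

variable {X : Type*} [MeasurableSpace X]

theorem weightedSum_cons (s : ℕ → X) (q : ℕ × ℕ) (l : List (ℕ × ℕ)) :
    weightedSum s (q :: l) = ((q.2 + 1 : ℕ) : ℝ≥0∞) • Measure.dirac (s q.1) + weightedSum s l := by
  simp [weightedSum]

theorem weightedSum_eq_map (s : ℕ → X) (l : List (ℕ × ℕ)) :
    weightedSum s l = (weightedSum id l).map s := by
  have hs : Measurable s := measurable_of_countable s
  induction l with
  | nil => simp [weightedSum]
  | cons q l ih =>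
    rw [weightedSum_cons, weightedSum_cons, Measure.map_add _ _ hs, Measure.map_smul,
      Measure.map_dirac' hs, ih, id]

theorem weightedSum_id_apply (b : ℕ → Bool) (l : List (ℕ × ℕ)) :
    weightedSum id l {j | b j = true} = weight b l := by
  induction l with
  | nil => simp [weightedSum, weight]
  | cons q l ih =>
    rw [weightedSum_cons, Measure.add_apply, ih, Measure.smul_apply,
      Measure.dirac_apply' _ .of_discrete]
    cases hq : b q.1 <;> simp [weight, hq]

theorem toMeasure_idealMeasure (s : ℕ → X) (n : ℕ) :
    (idealMeasure s n : Measure X)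
      = (weight (fun _ => true) (atoms n) : ℝ≥0∞)⁻¹ • weightedSum s (atoms n) := by
  have : weightedSum s (atoms n) Set.univ = (weight (fun _ => true) (atoms n) : ℝ≥0∞) := by
    simp [weightedSum_univ, weight]
  rw [← this]
  rfl

theorem idealMeasure_eq_map (s : ℕ → X) (n : ℕ) :
    (idealMeasure s n : Measure X) = (indexMeasure n : Measure ℕ).map s := by
  rw [indexMeasure, toMeasure_idealMeasure, toMeasure_idealMeasure, Measure.map_smul,
    weightedSum_eq_map]

theorem idealMeasure_reindex (s : ℕ → X) (d : ℕ → ℕ) (n : ℕ) :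
    idealMeasure s (reindex d n) = idealMeasure (s ∘ d) n := by
  refine Subtype.ext ?_
  change (idealMeasure s (reindex d n) : Measure X) = (idealMeasure (s ∘ d) n : Measure X)
  simp only [toMeasure_idealMeasure, atoms_reindex, weight, weightedSum, List.map_map,
    Function.comp_def]

theorem idealMeasure_real_apply (s : ℕ → X) (n : ℕ) {A : Set X} (hA : MeasurableSet A) :
    (idealMeasure s n : Measure X).real A = (indexMeasure n : Measure ℕ).real (s ⁻¹' A) := by
  rw [idealMeasure_eq_map, map_measureReal_apply (measurable_of_countable s) hA]

theorem indexMeasure_real_apply (b : ℕ → Bool) (n : ℕ) :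
    (indexMeasure n : Measure ℕ).real {j | b j = true}
      = weight b (atoms n) / weight (fun _ => true) (atoms n) := by
  rw [indexMeasure, toMeasure_idealMeasure, measureReal_ennreal_smul_apply, measureReal_def,
    weightedSum_id_apply, ENNReal.toReal_inv, ENNReal.toReal_natCast, ENNReal.toReal_natCast,
    inv_mul_eq_div]

end IdealMeasures

section LevyProkhorov

variable {X : Type*} [PseudoMetricSpace X] [MeasurableSpace X] [BorelSpace X]
  {μ ν : ProbabilityMeasure X} {c : ℝ}

theorem measureReal_le_of_dist_lt
    (h : dist (LevyProkhorov.ofMeasure μ) (LevyProkhorov.ofMeasure ν) < c) {A : Set X}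
    (hA : MeasurableSet A) :
    (μ : Measure X).real A ≤ (ν : Measure X).real (Metric.thickening c A) + c := by
  have hc : 0 < c := dist_nonneg.trans_lt h
  rw [← edist_lt_ofReal, LevyProkhorov.edist_probabilityMeasure_def] at h
  have hle := left_measure_le_of_levyProkhorovEDist_lt h hA
  rw [ENNReal.toReal_ofReal hc.le] at hle
  have hreal := ENNReal.toReal_mono (by finiteness) hle
  rwa [ENNReal.toReal_add (by finiteness) (by finiteness), ENNReal.toReal_ofReal hc.le] at hreal

theorem dist_le_of_measureReal_le (hc : 0 ≤ c) (h : ∀ ε > c, ∀ A, MeasurableSet A →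
      (μ : Measure X).real A ≤ (ν : Measure X).real (Metric.thickening ε A) + ε) :
    dist (LevyProkhorov.ofMeasure μ) (LevyProkhorov.ofMeasure ν) ≤ c := by
  rw [LevyProkhorov.dist_probabilityMeasure_def]
  refine levyProkhorovDist_le_of_forall_le _ _ hc fun ε A hε hA => ?_
  change (μ : Measure X) A ≤ (ν : Measure X) (Metric.thickening ε A) + _
  rw [← ofReal_measureReal, ← ofReal_measureReal,
    ← ENNReal.ofReal_add measureReal_nonneg (hc.trans hε.le)]
  exact ENNReal.ofReal_le_ofReal (h ε hε A hA)

end LevyProkhorov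

section MeasureNames

variable {X : Type*} [MetricSpace X] [MeasurableSpace X] [BorelSpace X] {s : ℕ → X}
  {σ : ℕ → ℕ} {μ : ProbabilityMeasure X}

theorem measureReal_le_indexMeasure
    (hσ : CauchyName (fun n => LevyProkhorov.ofMeasure (idealMeasure s n)) σ
      (LevyProkhorov.ofMeasure μ)) (t : ℕ) {A : Set X} (hA : MeasurableSet A) :
    (μ : Measure X).real A ≤ (indexMeasure (σ t) : Measure ℕ).real
      {j | ∃ x ∈ A, dist (s j) x < 4 / 2 ^ t} + 4 / 2 ^ t := by
  have h := measureReal_le_of_dist_lt ((dist_comm _ _).trans_lt (hσ.dist_lt t)) hA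
  rw [idealMeasure_real_apply s _ Metric.isOpen_thickening.measurableSet] at h
  simpa only [Set.preimage, Metric.mem_thickening_iff] using h

theorem indexMeasure_le_measureReal
    (hσ : CauchyName (fun n => LevyProkhorov.ofMeasure (idealMeasure s n)) σ
      (LevyProkhorov.ofMeasure μ)) (t : ℕ) (J : Set ℕ) :
    (indexMeasure (σ t) : Measure ℕ).real J ≤ (μ : Measure X).real
      {x | ∃ j ∈ J, dist (s j) x < 4 / 2 ^ t} + 4 / 2 ^ t := by
  have hJ : MeasurableSet (s '' J) := (J.to_countable.image s).measurableSet
  calc (indexMeasure (σ t) : Measure ℕ).real J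
      ≤ (idealMeasure s (σ t) : Measure X).real (s '' J) := by
        rw [idealMeasure_real_apply s _ hJ]
        exact measureReal_mono (Set.subset_preimage_image s J)
    _ ≤ (μ : Measure X).real (Metric.thickening (4 / 2 ^ t) (s '' J)) + 4 / 2 ^ t :=
        measureReal_le_of_dist_lt (hσ.dist_lt t) hJ
    _ = _ := by
        congr 2 with x
        simp [Metric.mem_thickening_iff, dist_comm]

end MeasureNames

/-! ### The threshold -/

section NestedIntervals

theorem memDyadic_iff_mem_Icc {t a : ℕ} {β : ℝ} :
    MemDyadic t a β ↔ β ∈ Set.Icc ((a : ℝ) / 2 ^ t) ((a + 1) / 2 ^ t) := by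
  rw [Set.mem_Icc, div_le_iff₀' (by positivity), le_div_iff₀' (by positivity), MemDyadic]

theorem memDyadic_floor {β : ℝ} (hβ : 0 ≤ β) (t : ℕ) : MemDyadic t ⌊2 ^ t * β⌋₊ β :=
  ⟨Nat.floor_le (by positivity), (Nat.lt_floor_add_one _).le⟩

theorem MemDyadic.of_div {t t' a' : ℕ} {β : ℝ} (h : MemDyadic t' a' β) (ht : t ≤ t') :
    MemDyadic t (a' / 2 ^ (t' - t)) β := by
  obtain ⟨d, rfl⟩ := Nat.exists_eq_add_of_le ht
  rw [Nat.add_sub_cancel_left]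
  have hd : (0 : ℝ) < 2 ^ d := by positivity
  have hlo : ((a' / 2 ^ d : ℕ) : ℝ) * 2 ^ d ≤ a' := by exact_mod_cast Nat.div_mul_le_self a' (2 ^ d)
  have hhi : (a' : ℝ) + 1 ≤ ((a' / 2 ^ d : ℕ) + 1) * 2 ^ d := by
    exact_mod_cast Nat.lt_div_mul_add (a := a') (Nat.two_pow_pos d) |>.trans_eq (by ring)
  have hβ : 2 ^ (t + d) * β = 2 ^ t * β * 2 ^ d := by ring
  constructor <;> refine le_of_mul_le_mul_right ?_ hd
  · linarith [h.1]
  · linarith [h.2]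

theorem exists_memDyadic_of_nested {T a : ℕ → ℕ} (hT : ∀ n, T n ≤ T (n + 1))
    (ha : ∀ n, a (n + 1) / 2 ^ (T (n + 1) - T n) = a n) : ∃ β, ∀ n, MemDyadic (T n) (a n) β := by
  have hset : ∀ n, {β | MemDyadic (T n) (a n) β} =
      Set.Icc ((a n : ℝ) / 2 ^ T n) ((a n + 1) / 2 ^ T n) :=
    fun n => Set.ext fun β => memDyadic_iff_mem_Icc
  have hne := IsCompact.nonempty_iInter_of_sequence_nonempty_isCompact_isClosed
    (fun n => {β | MemDyadic (T n) (a n) β})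
    (fun n β hβ => ha n ▸ MemDyadic.of_div hβ (hT n))
    (fun n => by rw [hset]; exact Set.nonempty_Icc.2 (by gcongr; linarith))
    (by rw [hset]; exact isCompact_Icc)
    (fun n => by rw [hset]; exact isClosed_Icc)
  obtain ⟨β, hβ⟩ := hne
  exact ⟨β, Set.mem_iInter.1 hβ⟩

theorem floor_two_pow_mul_div {t t' a : ℕ} {β : ℝ} (ht : t ≤ t') (hlo : (a : ℝ) / 2 ^ t < β)
    (hhi : β < (a + 1) / 2 ^ t) : ⌊2 ^ t' * β⌋₊ / 2 ^ (t' - t) = a := by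
  have hβ : 0 ≤ β := le_trans (by positivity) hlo.le
  obtain ⟨d, rfl⟩ := Nat.exists_eq_add_of_le ht
  have hscale : 2 ^ (t + d) * β / ((2 ^ (t + d - t) : ℕ) : ℝ) = 2 ^ t * β := by
    rw [Nat.add_sub_cancel_left, pow_add]
    push_cast
    field_simp
  rw [← Nat.floor_div_natCast, hscale, Nat.floor_eq_iff (by positivity)]
  exact ⟨((div_lt_iff₀' (by positivity)).1 hlo).le, (lt_div_iff₀' (by positivity)).1 hhi⟩

theorem exists_computable_nested {Q : ℕ → ℕ → ℕ → Bool}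
    (hQ : Computable fun p : ℕ × ℕ × ℕ => Q p.1 p.2.1 p.2.2)
    (h : ∀ n t a, ∃ t' a', t ≤ t' ∧ a' / 2 ^ (t' - t) = a ∧ Q n t' a' = true) (t₀ a₀ : ℕ) :
    ∃ (T a : ℕ → ℕ) (β : ℝ), Computable T ∧ Computable a ∧ MemDyadic t₀ a₀ β ∧
      ∀ n, MemDyadic (T n) (a n) β ∧ Q n (T n) (a n) = true := by
  obtain ⟨next, hnext, hspec⟩ := exists_computable_choice
    (P := fun (p : ℕ × ℕ) r => decide (p.2.unpair.1 ≤ r.unpair.1) &&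
      (decide (r.unpair.2 / 2 ^ (r.unpair.1 - p.2.unpair.1) = p.2.unpair.2) &&
        Q p.1 r.unpair.1 r.unpair.2))
    (computable_and (computable_decide_le (by fun_prop) (by fun_prop)) (computable_and
      (computable_decide_eq (by fun_prop) (by fun_prop)) (by fun_prop))) fun p => by
      obtain ⟨t', a', ht, ha, hq⟩ := h p.1 p.2.unpair.1 p.2.unpair.2
      refine ⟨Nat.pair t' a', ?_⟩
      simp only [Nat.unpair_pair, Bool.and_eq_true, decide_eq_true_eq]
      exact ⟨ht, ha, hq⟩
  simp only [Bool.and_eq_true, decide_eq_true_eq] at hspec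
  let S : ℕ → ℕ := fun n => Nat.rec (Nat.pair t₀ a₀) (fun n s => next (n, s)) n
  have hS : Computable S := by fun_prop
  obtain ⟨β, hβ⟩ := exists_memDyadic_of_nested (T := fun n => (S n).unpair.1)
    (a := fun n => (S n).unpair.2) (fun n => (hspec (n, S n)).1) (fun n => (hspec (n, S n)).2.1)
  refine ⟨fun n => (S (n + 1)).unpair.1, fun n => (S (n + 1)).unpair.2, β, by fun_prop, by fun_prop,
    ?_, fun n => ⟨hβ (n + 1), (hspec (n, S n)).2.2⟩⟩
  simpa [S] using hβ 0

end NestedIntervals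

section Threshold

theorem tendsto_measureReal_abs_sub_le {Ω : Type*} [MeasurableSpace Ω] (μ : Measure Ω)
    [IsFiniteMeasure μ] {f : Ω → ℝ} (hf : Measurable f) {β : ℝ} (h : μ {x | f x = β} = 0) :
    Tendsto (fun ε => μ.real {x | |f x - β| ≤ ε}) (𝓝[≥] 0) (𝓝 0) := by
  have hlim := tendsto_measure_cthickening_of_isClosed (μ := μ.map f) (s := {β})
    ⟨1, one_pos, measure_ne_top _ _⟩ isClosed_singleton
  rw [Measure.map_apply hf (measurableSet_singleton β)] at hlim
  change Tendsto _ _ (𝓝 (μ {x | f x = β})) at hlim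
  rw [h] at hlim
  refine ((ENNReal.tendsto_toReal ENNReal.zero_ne_top).comp
    (hlim.mono_left nhdsWithin_le_nhds)).congr' ?_
  filter_upwards [self_mem_nhdsWithin] with ε hε
  rw [Function.comp_apply, Metric.cthickening_singleton _ hε,
    Measure.map_apply hf Metric.isClosed_closedBall.measurableSet, measureReal_def]
  rfl

variable {X : Type*} [MetricSpace X] [ComputableMetricSpace X]

namespace LevelApproximation

variable (A : LevelApproximation X) (σ : ℕ → ℕ) (n t a : ℕ)

/-- The dyadic interval `[a / 2 ^ t, (a + 1) / 2 ^ t]` is admissible at stage `n`: the first levels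
of the first ideal points are visibly away from it, and so are those of a random atom of the ideal
measure with index `σ t`, except with probability at most `2 ^ (-n)`. -/
def admissible : Bool :=
  decide (n ≤ t) && (((List.range (n + 1)).all fun j => A.separated t a n j) &&
    decide (weight (fun j => !A.separated t a n j) (atoms (σ t)) * 2 ^ n
      ≤ weight (fun _ => true) (atoms (σ t))))

variable {σ n t a}

@[fun_prop]
theorem computable_admissible {α : Type*} [Primcodable α] {n t a : α → ℕ} (hσ : Computable σ)
    (hn : Computable n) (ht : Computable t) (ha : Computable a) :
    Computable fun x => A.admissible σ (n x) (t x) (a x) := by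
  unfold admissible
  fun_prop

theorem admissible_eq_true : A.admissible σ n t a = true ↔
    n ≤ t ∧ (∀ j ≤ n, A.separated t a n j = true) ∧
      (indexMeasure (σ t) : Measure ℕ).real {j | A.separated t a n j = false} ≤ (1 / 2) ^ n := by
  have hmass := indexMeasure_real_apply (fun j => !A.separated t a n j) (σ t)
  have hpos : (0 : ℝ) < weight (fun _ => true) (atoms (σ t)) := by
    exact_mod_cast weight_true_atoms_pos (σ t)
  simp only [Bool.not_eq_true'] at hmass
  rw [hmass, div_le_iff₀ hpos, one_div_pow, one_div, inv_mul_eq_div, le_div_iff₀ (by positivity)]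
  simp only [admissible, Bool.and_eq_true, decide_eq_true_eq, List.all_eq_true, List.mem_range,
    Nat.lt_succ_iff]
  norm_cast

variable [MeasurableSpace X] [BorelSpace X] {μ : ProbabilityMeasure X} {β : ℝ}

theorem indexMeasure_not_separated_le
    (hσ : CauchyName (fun n => LevyProkhorov.ofMeasure
      (idealMeasure (ComputableMetricSpace.ideal : ℕ → X) n)) σ (LevyProkhorov.ofMeasure μ))
    (hβ : MemDyadic t a β) :
    (indexMeasure (σ t) : Measure ℕ).real {j | A.separated t a n j = false} ≤
      ∑ i ∈ Finset.range (n + 1),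
        (μ : Measure X).real {x | |level i x - β| ≤ 14 * 2 ^ i.unpair.2 / 2 ^ t} + 4 / 2 ^ t := by
  refine (indexMeasure_le_measureReal hσ t _).trans ?_
  gcongr
  refine (measureReal_mono ?_ (measure_ne_top _ _)).trans (measureReal_biUnion_finset_le _ _)
  rintro x ⟨j, hj, hx⟩
  have hnot : ¬ ∀ i ≤ n, A.far t a i j = true := by
    rw [← A.separated_eq_true, Bool.not_eq_true]
    exact hj
  push Not at hnot
  obtain ⟨i, hi, hfar⟩ := hnot
  exact Set.mem_biUnion (Finset.mem_coe.2 (Finset.mem_range_succ_iff.2 hi))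
    (A.abs_level_sub_le_of_not_far hβ (Bool.eq_false_of_not_eq_true hfar) hx.le)

theorem eventually_indexMeasure_not_separated_le
    (hσ : CauchyName (fun n => LevyProkhorov.ofMeasure
      (idealMeasure (ComputableMetricSpace.ideal : ℕ → X) n)) σ (LevyProkhorov.ofMeasure μ))
    (hnull : ∀ i, (μ : Measure X) {x | level i x = β} = 0) {ε : ℝ} (hε : 0 < ε) :
    ∀ᶠ t : ℕ in atTop, ∀ a, MemDyadic t a β →
      (indexMeasure (σ t) : Measure ℕ).real {j | A.separated t a n j = false} ≤ ε := by
  have hradius : ∀ c : ℝ, Tendsto (fun t : ℕ => c / (2 : ℝ) ^ t) atTop (𝓝 0) := fun c =>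
    tendsto_const_nhds.div_atTop (tendsto_pow_atTop_atTop_of_one_lt one_lt_two)
  have hlevel : ∀ i, Tendsto (fun t : ℕ => (μ : Measure X).real
      {x | |level i x - β| ≤ 14 * 2 ^ i.unpair.2 / 2 ^ t}) atTop (𝓝 0) := fun i =>
    (tendsto_measureReal_abs_sub_le _ (continuous_level i).measurable (hnull i)).comp
      (tendsto_nhdsWithin_iff.2 ⟨hradius _, .of_forall fun t => Set.mem_Ici.2 (by positivity)⟩)
  have hbound := (tendsto_finsetSum (Finset.range (n + 1)) fun i _ => hlevel i).add (hradius 4)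
  rw [Finset.sum_const_zero, add_zero] at hbound
  filter_upwards [hbound.eventually_lt_const hε] with t ht a hβ
  exact (A.indexMeasure_not_separated_le hσ hβ).trans ht.le

theorem eventually_admissible
    (hσ : CauchyName (fun n => LevyProkhorov.ofMeasure
      (idealMeasure (ComputableMetricSpace.ideal : ℕ → X) n)) σ (LevyProkhorov.ofMeasure μ))
    (hnull : ∀ i, (μ : Measure X) {x | level i x = β} = 0)
    (hideal : ∀ i j, level i (ComputableMetricSpace.ideal j : X) ≠ β) (n : ℕ) :
    ∀ᶠ t : ℕ in atTop, ∀ a, MemDyadic t a β → A.admissible σ n t a = true := by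
  have hsep := (Set.finite_Iic n).eventually_all.2 fun j _ =>
    A.eventually_separated (n := n) fun i _ => hideal i j
  filter_upwards [eventually_ge_atTop n, hsep, A.eventually_indexMeasure_not_separated_le hσ hnull
    (show (0 : ℝ) < (1 / 2) ^ n by positivity)] with t hn hsep hmass a hβ
  refine A.admissible_eq_true.2 ⟨hn, fun j hj => hsep j hj a j hβ ?_, hmass a hβ⟩
  rw [dist_self]
  positivity

end LevelApproximation

variable [MeasurableSpace X] [BorelSpace X]

theorem exists_null_level (μ : Measure X) [SFinite μ] {a b : ℝ} (hab : a < b) :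
    ∃ β, a < β ∧ β < b ∧ (∀ i, μ {x | level i x = β} = 0) ∧
      ∀ i j, level i (ComputableMetricSpace.ideal j : X) ≠ β := by
  have hc : (⋃ i, {β : ℝ | 0 < μ {x | level i x = β}} ∪
      Set.range fun j => level i (ComputableMetricSpace.ideal j : X)).Countable :=
    Set.countable_iUnion fun i => (Measure.countable_meas_level_set_pos
      (continuous_level i).measurable).union (Set.countable_range _)
  obtain ⟨β, hβ, haβ, hβb⟩ := (hc.dense_compl ℝ).exists_between hab
  simp only [Set.mem_compl_iff, Set.mem_iUnion, Set.mem_union, not_exists, not_or] at hβ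
  exact ⟨β, haβ, hβb, fun i => nonpos_iff_eq_zero.1 (not_lt.1 (hβ i).1),
    fun i j h => (hβ i).2 ⟨j, h⟩⟩

/-- A number `α` that is not a level of an ideal point and is the value of each level on a null set
only, together with computable dyadic intervals around it that witness this. -/
structure Threshold (μ : ProbabilityMeasure X) where
  /-- The approximations of the levels of the ideal points. -/
  approx : LevelApproximation X
  /-- A name of the measure. -/
  σ : ℕ → ℕ
  computable_σ : Computable σ
  cauchyName : CauchyName (fun n => LevyProkhorov.ofMeasure
    (idealMeasure (ComputableMetricSpace.ideal : ℕ → X) n)) σ (LevyProkhorov.ofMeasure μ)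
  /-- The precisions of the intervals. -/
  T : ℕ → ℕ
  computable_T : Computable T
  /-- The left endpoint of the `n`-th interval is `a n / 2 ^ T n`. -/
  a : ℕ → ℕ
  computable_a : Computable a
  /-- The threshold. -/
  α : ℝ
  one_le : 1 ≤ α
  le_two : α ≤ 2
  memDyadic (n : ℕ) : MemDyadic (T n) (a n) α
  admissible (n : ℕ) : approx.admissible σ n (T n) (a n) = true

theorem nonempty_threshold {μ : ProbabilityMeasure X} (hμ : IsComputableMeasure μ) :
    Nonempty (Threshold μ) := by
  obtain ⟨A⟩ := nonempty_levelApproximation X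
  obtain ⟨σ, hσ, hname⟩ := hμ
  have hrefine : ∀ n t a, ∃ t' a', t ≤ t' ∧ a' / 2 ^ (t' - t) = a ∧
      A.admissible σ n t' a' = true := by
    intro n t a
    obtain ⟨β, hlo, hhi, hnull, hideal⟩ := exists_null_level (μ : Measure X)
      (show (a : ℝ) / 2 ^ t < (a + 1) / 2 ^ t by gcongr; linarith)
    obtain ⟨t', hadm, ht⟩ := ((A.eventually_admissible hname hnull hideal n).and
      (eventually_ge_atTop t)).exists
    exact ⟨t', ⌊2 ^ t' * β⌋₊, ht, floor_two_pow_mul_div ht hlo hhi,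
      hadm _ (memDyadic_floor (le_trans (by positivity) hlo.le) t')⟩
  obtain ⟨T, a, α, hT, ha, hα, hTa⟩ := exists_computable_nested (by fun_prop) hrefine 0 1
  norm_num [MemDyadic] at hα
  exact ⟨⟨A, σ, hσ, hname, T, hT, a, ha, α, hα.1, hα.2, fun n => (hTa n).1, fun n => (hTa n).2⟩⟩

end Threshold

/-! ### The expansion of a point -/

section Cantor

theorem cantor_dist_le {ω ω' : ℕ → Bool} {n : ℕ} (h : ∀ i < n, ω i = ω' i) :
    dist ω ω' ≤ (1 / 2) ^ n :=
  (PiNat.mem_cylinder_iff_dist_le (E := fun _ => Bool)).1 h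

theorem cantor_apply_eq {ω ω' : ℕ → Bool} {n i : ℕ} (h : dist ω ω' ≤ (1 / 2) ^ n) (hi : i < n) :
    ω i = ω' i :=
  (PiNat.mem_cylinder_iff_dist_le (E := fun _ => Bool)).2 h i hi

theorem cantor_mem_ball {ω ω' : ℕ → Bool} {n : ℕ} :
    ω' ∈ Metric.ball ω ((1 / 2) ^ n) ↔ ∀ i ≤ n, ω' i = ω i := by
  rw [Metric.mem_ball]
  refine ⟨fun h i hi => PiNat.apply_eq_of_dist_lt (E := fun _ => Bool) h hi, fun h => ?_⟩
  exact (cantor_dist_le fun i hi => h i (Nat.lt_succ_iff.1 hi)).trans_lt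
    (pow_lt_pow_right_of_lt_one₀ (by norm_num) (by norm_num) (Nat.lt_succ_self n))

theorem CauchyName.testBit_eq {σ : ℕ → ℕ} {ω : ℕ → Bool}
    (hσ : CauchyName ComputableMetricSpace.ideal σ ω) (l : ℕ) : (σ (l + 2)).testBit l = ω l := by
  refine cantor_apply_eq (ω := (σ (l + 2)).testBit) ((hσ.dist_le (l + 2)).trans_eq ?_)
    (Nat.lt_succ_self l)
  rw [one_div_pow, pow_succ 2 (l + 1)]
  field_simp

/-- The code of the ideal ball of radius `2 ^ (-l)` about the `j`-th ideal point. -/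
def dyadicBall (j l : ℕ) : ℕ := Nat.pair j (Nat.pair 0 (2 ^ l - 1))

theorem idealBall_dyadicBall {X : Type*} [MetricSpace X] [ComputableMetricSpace X] (j l : ℕ) :
    idealBall X (dyadicBall j l) = Metric.ball (ComputableMetricSpace.ideal j) ((1 / 2) ^ l) := by
  have h : 1 ≤ 2 ^ l := Nat.one_le_two_pow
  simp [idealBall, dyadicBall, posRatNum, Nat.cast_sub h]

@[fun_prop]
theorem computable_dyadicBall {α : Type*} [Primcodable α] {f g : α → ℕ} (hf : Computable f)
    (hg : Computable g) : Computable fun a => dyadicBall (f a) (g a) := by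
  unfold dyadicBall
  fun_prop

end Cantor

section Expansion

variable {X : Type*} [MetricSpace X] [ComputableMetricSpace X] [MeasurableSpace X] [BorelSpace X]

namespace Threshold

attribute [fun_prop] computable_σ computable_T computable_a

variable {μ : ProbabilityMeasure X} (θ : Threshold μ)

/-- The expansion of a point defined by the threshold: the sequence that tells which levels of the
point lie below it. -/
noncomputable def expansion (x : X) (n : ℕ) : Bool := decide (level n x < θ.α)

/-- The points none of whose levels equals the threshold. On them the expansion is computable. -/
def regular : Set X := {x | ∀ n, level n x ≠ θ.α}

variable {x : X} {l m n i j : ℕ}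

theorem tendsto_T : Tendsto θ.T atTop atTop :=
  tendsto_atTop_mono (fun n => (θ.approx.admissible_eq_true.1 (θ.admissible n)).1) tendsto_id

theorem four_div_two_pow_T_le (n : ℕ) : (4 : ℝ) / 2 ^ θ.T n ≤ 4 * (1 / 2) ^ n := by
  have hn := (θ.approx.admissible_eq_true.1 (θ.admissible n)).1
  rw [one_div_pow, mul_one_div]
  gcongr
  norm_num

theorem level_ne_of_separated (h : θ.approx.separated (θ.T l) (θ.a l) n j = true)
    (hx : dist (ComputableMetricSpace.ideal j) x ≤ 4 / 2 ^ θ.T l) (hi : i ≤ n) :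
    level i x ≠ θ.α :=
  (θ.approx.level_ne_and_below_eq_of_far (θ.memDyadic l) (θ.approx.separated_eq_true.1 h i hi) hx).1

theorem testBit_digits_of_separated (h : θ.approx.separated (θ.T l) (θ.a l) n j = true)
    (hx : dist (ComputableMetricSpace.ideal j) x ≤ 4 / 2 ^ θ.T l) (hi : i ≤ n) :
    (θ.approx.digits (θ.T l) (θ.a l) n j).testBit i = θ.expansion x i := by
  rw [θ.approx.testBit_digits hi]
  exact (θ.approx.level_ne_and_below_eq_of_far (θ.memDyadic l)
    (θ.approx.separated_eq_true.1 h i hi) hx).2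

theorem eventually_far (hx : level n x ≠ θ.α) : ∀ᶠ l in atTop, ∀ j,
    dist (ComputableMetricSpace.ideal j) x ≤ 4 / 2 ^ θ.T l →
      θ.approx.far (θ.T l) (θ.a l) n j = true :=
  (θ.tendsto_T.eventually (θ.approx.eventually_far hx)).mono fun l h j hj =>
    h (θ.a l) j (θ.memDyadic l) hj

theorem eventually_separated (hx : x ∈ θ.regular) (n : ℕ) : ∀ᶠ l in atTop, ∀ j,
    dist (ComputableMetricSpace.ideal j) x ≤ 4 / 2 ^ θ.T l →
      θ.approx.separated (θ.T l) (θ.a l) n j = true :=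
  (θ.tendsto_T.eventually (θ.approx.eventually_separated fun i _ => hx i)).mono fun l h j hj =>
    h (θ.a l) j (θ.memDyadic l) hj

theorem ideal_mem_regular (j : ℕ) : (ComputableMetricSpace.ideal j : X) ∈ θ.regular := fun n =>
  θ.level_ne_of_separated
    ((θ.approx.admissible_eq_true.1 (θ.admissible (max n j))).2.1 j (le_max_right n j))
    (by rw [dist_self]; positivity) (le_max_left n j)

theorem dense_regular : Dense θ.regular :=
  ComputableMetricSpace.denseRange_ideal.mono (Set.range_subset_iff.2 θ.ideal_mem_regular)

theorem level_ne_iff : level n x ≠ θ.α ↔ ∃ j l, θ.approx.far (θ.T l) (θ.a l) n j = true ∧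
    x ∈ Metric.ball (ComputableMetricSpace.ideal j) ((1 / 2 : ℝ) ^ θ.T l) := by
  have hradius : ∀ t : ℕ, (1 / 2 : ℝ) ^ t ≤ 4 / 2 ^ t := fun t => by
    rw [one_div_pow]
    gcongr
    norm_num
  constructor
  · intro hx
    obtain ⟨l, hl⟩ := (θ.eventually_far hx).exists
    obtain ⟨j, hj⟩ := ComputableMetricSpace.denseRange_ideal.exists_dist_lt x
      (show (0 : ℝ) < (1 / 2) ^ θ.T l by positivity)
    exact ⟨j, l, hl j ((dist_comm _ _).trans_le (hj.le.trans (hradius _))), hj⟩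
  · rintro ⟨j, l, hfar, hx⟩
    exact (θ.approx.level_ne_and_below_eq_of_far (θ.memDyadic l) hfar
      ((Metric.mem_ball'.1 hx).le.trans (hradius _))).1

theorem isPiZeroTwo_regular : IsPiZeroTwo θ.regular := by
  refine ⟨fun n => {x | level n x ≠ θ.α}, uniformlyREOpen_of_computable
    (P := fun n p => θ.approx.far (θ.T p.unpair.2) (θ.a p.unpair.2) n p.unpair.1)
    (g := fun _ p => dyadicBall p.unpair.1 (θ.T p.unpair.2)) (by fun_prop) (by fun_prop)
    fun n x => ?_, Set.ofPred_forall _⟩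
  simp only [Set.mem_ofPred_eq, idealBall_dyadicBall, level_ne_iff]
  constructor
  · rintro ⟨j, l, h⟩
    exact ⟨Nat.pair j l, by simpa only [Nat.unpair_pair] using h⟩
  · rintro ⟨p, h⟩
    exact ⟨_, _, h⟩

theorem measureReal_le_indexMeasure_add (n : ℕ) {A : Set X} (hA : MeasurableSet A) {J : Set ℕ}
    (hJ : ∀ j, θ.approx.separated (θ.T n) (θ.a n) n j = true →
      (∃ x ∈ A, dist (ComputableMetricSpace.ideal j) x ≤ 4 / 2 ^ θ.T n) → j ∈ J) :
    (μ : Measure X).real A ≤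
      (indexMeasure (θ.σ (θ.T n)) : Measure ℕ).real J + 5 * (1 / 2) ^ n := by
  have hsub : {j | ∃ x ∈ A, dist (ComputableMetricSpace.ideal j) x < 4 / 2 ^ θ.T n} ⊆
      J ∪ {j | θ.approx.separated (θ.T n) (θ.a n) n j = false} := by
    rintro j ⟨x, hx, hj⟩
    cases hs : θ.approx.separated (θ.T n) (θ.a n) n j
    · exact Or.inr hs
    · exact Or.inl (hJ j hs ⟨x, hx, hj.le⟩)
  have hunion := (measureReal_mono hsub).trans (measureReal_union_le
    (μ := (indexMeasure (θ.σ (θ.T n)) : Measure ℕ)) _ _)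
  linarith [measureReal_le_indexMeasure θ.cauchyName (θ.T n) hA, θ.four_div_two_pow_T_le n,
    (θ.approx.admissible_eq_true.1 (θ.admissible n)).2.2]

theorem measure_level_eq (i : ℕ) : (μ : Measure X) {x | level i x = θ.α} = 0 := by
  rw [← measureReal_eq_zero_iff]
  refine le_antisymm ?_ measureReal_nonneg
  have hlim : Tendsto (fun n : ℕ => 5 * (1 / 2 : ℝ) ^ n) atTop (𝓝 0) := by
    simpa using (tendsto_pow_atTop_nhds_zero_of_lt_one (by norm_num : (0 : ℝ) ≤ 1 / 2)
      (by norm_num)).const_mul (5 : ℝ)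
  have hm : MeasurableSet {x : X | level i x = θ.α} :=
    (isClosed_eq (continuous_level i) continuous_const).measurableSet
  refine ge_of_tendsto hlim ?_
  filter_upwards [eventually_ge_atTop i] with n hn
  refine (θ.measureReal_le_indexMeasure_add n hm (J := ∅) ?_).trans_eq (by simp)
  rintro j hs ⟨x, hx, hj⟩
  exact θ.level_ne_of_separated hs hj hn hx

theorem measure_regular : (μ : Measure X) θ.regular = 1 := by
  rw [← prob_compl_eq_zero_iff θ.isPiZeroTwo_regular.measurableSet]
  refine measure_mono_null (fun x hx => ?_) (measure_iUnion_null θ.measure_level_eq)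
  simpa [regular] using hx

theorem computableOn_expansion : ComputableOn fun x : θ.regular => θ.expansion x := by
  refine computableOn_of_queries (q := θ.T)
    (g := fun m l j => bif θ.approx.separated (θ.T l) (θ.a l) m j
      then some (θ.approx.digits (θ.T l) (θ.a l) m j) else none)
    θ.computable_T (by fun_prop) (fun x σ hσ m => ?_) fun x σ hσ m l b hb => ?_
  · obtain ⟨l, hl⟩ := (θ.eventually_separated x.2 m).exists
    exact ⟨l, by rw [hl _ (hσ.dist_lt _).le]; rfl⟩
  · cases hs : θ.approx.separated (θ.T l) (θ.a l) m (σ (θ.T l))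
    · simp [hs] at hb
    · rw [hs, cond_true, Option.some_inj] at hb
      subst hb
      exact cantor_dist_le fun i hi =>
        θ.testBit_digits_of_separated hs (hσ.dist_lt _).le (Nat.lt_succ_iff.1 hi)

/-! ### The distribution of the expansion -/

theorem measurable_expansion : Measurable θ.expansion := by
  refine measurable_pi_iff.2 fun n => measurable_to_bool ?_
  have hpre : (fun x => θ.expansion x n) ⁻¹' {true} = {x | level n x < θ.α} := by
    ext x
    simp [expansion]
  rw [hpre]
  exact (isOpen_lt (continuous_level n) continuous_const).measurableSet

/-- The distribution of the expansion of a random point. -/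
noncomputable def law : ProbabilityMeasure (ℕ → Bool) := μ.map θ.measurable_expansion.aemeasurable

theorem law_apply {A : Set (ℕ → Bool)} (hA : MeasurableSet A) :
    (θ.law : Measure (ℕ → Bool)) A = (μ : Measure X) (θ.expansion ⁻¹' A) := by
  rw [law, ProbabilityMeasure.toMeasure_map, Measure.map_apply θ.measurable_expansion hA]

theorem dist_law_le (n : ℕ) :
    dist (LevyProkhorov.ofMeasure (idealMeasure (ComputableMetricSpace.ideal : ℕ → (ℕ → Bool))
      (reindex (θ.approx.digits (θ.T n) (θ.a n) n) (θ.σ (θ.T n)))))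
      (LevyProkhorov.ofMeasure θ.law) ≤ 2 ^ 3 * (1 / 2) ^ n := by
  have hpos : (0 : ℝ) < (1 / 2) ^ n := by positivity
  rw [dist_comm, idealMeasure_reindex]
  refine dist_le_of_measureReal_le (by positivity) fun ε hε B hB => ?_
  rw [idealMeasure_real_apply _ _ Metric.isOpen_thickening.measurableSet, measureReal_def,
    θ.law_apply hB, ← measureReal_def]
  refine (θ.measureReal_le_indexMeasure_add n (θ.measurable_expansion hB) ?_).trans
    (add_le_add_right (by linarith) _)
  rintro j hs ⟨x, hx, hj⟩
  refine Metric.mem_thickening_iff.2 ⟨θ.expansion x, hx, ?_⟩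
  exact (cantor_dist_le fun i hi => θ.testBit_digits_of_separated hs hj hi.le).trans_lt
    (by linarith)

theorem isComputableMeasure_law : IsComputableMeasure θ.law :=
  constructivePoint_of_dist_le (by fun_prop) 3 θ.dist_law_le

end Threshold

end Expansion

/-! ### Decoding -/

section Decoding

variable {X : Type*} [MetricSpace X] [ComputableMetricSpace X] [MeasurableSpace X] [BorelSpace X]

namespace Threshold

variable {μ : ProbabilityMeasure X} (θ : Threshold μ)

/-- The sequence `ω` is a possible expansion of `x`, ties between a level and the threshold being
broken arbitrarily. -/
def Represents (ω : ℕ → Bool) (x : X) : Prop :=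
  ∀ n, (ω n = true → level n x ≤ θ.α) ∧ (ω n = false → θ.α ≤ level n x)

/-- The domain of the decoding map: the sequences that have, for every `N`, a prefix ending in a
digit `1` at scale `N` and shared with the expansion of an ideal point. -/
def codes : Set (ℕ → Bool) :=
  {ω | ∀ N, ∃ i j, θ.expansion (ComputableMetricSpace.ideal j) (Nat.pair i N) = true ∧
    ∀ n ≤ Nat.pair i N, ω n = θ.expansion (ComputableMetricSpace.ideal j) n}

variable {θ} {ω : ℕ → Bool} {x y : X}

theorem exists_apply_eq_true (hω : ω ∈ θ.codes) (N : ℕ) : ∃ i, ω (Nat.pair i N) = true := by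
  obtain ⟨i, j, hone, hagree⟩ := hω N
  exact ⟨i, (hagree _ le_rfl).trans hone⟩

theorem dist_le_of_level_le {i k : ℕ} (h : level (Nat.pair i k) x ≤ θ.α) :
    dist (ComputableMetricSpace.ideal i) x ≤ 2 * (1 / 2) ^ k := by
  rw [level, Nat.unpair_pair] at h
  rw [one_div_pow, mul_one_div, le_div_iff₀' (by positivity)]
  exact h.trans θ.le_two

theorem level_lt_of_dist_lt {i k : ℕ} (h : dist x (ComputableMetricSpace.ideal i) < (1 / 2) ^ k) :
    level (Nat.pair i k) x < θ.α := by
  rw [dist_comm, one_div_pow, lt_div_iff₀' (by positivity)] at h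
  rw [level, Nat.unpair_pair]
  exact h.trans_le θ.one_le

namespace Represents

theorem dist_le (h : θ.Represents ω x) {i k : ℕ} (hi : ω (Nat.pair i k) = true) :
    dist (ComputableMetricSpace.ideal i) x ≤ 2 * (1 / 2) ^ k :=
  dist_le_of_level_le ((h _).1 hi)

theorem unique (hω : ω ∈ θ.codes) (hx : θ.Represents ω x) (hy : θ.Represents ω y) : x = y := by
  have hlim : Tendsto (fun n : ℕ => 4 * (1 / 2 : ℝ) ^ n) atTop (𝓝 0) := by
    simpa using (tendsto_pow_atTop_nhds_zero_of_lt_one (by norm_num : (0 : ℝ) ≤ 1 / 2)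
      (by norm_num)).const_mul (4 : ℝ)
  refine dist_le_zero.1 (ge_of_tendsto' hlim fun k => ?_)
  obtain ⟨i, hi⟩ := exists_apply_eq_true hω k
  linarith [hx.dist_le hi, hy.dist_le hi, dist_triangle_left x y (ComputableMetricSpace.ideal i)]

theorem eq_expansion (h : θ.Represents ω x) (hx : x ∈ θ.regular) : ω = θ.expansion x := by
  funext n
  cases hn : ω n
  · exact (decide_eq_false (not_lt.2 ((h n).2 hn))).symm
  · exact (decide_eq_true (lt_of_le_of_ne ((h n).1 hn) (hx n))).symm

end Represents

theorem represents_of_tendsto {u : ℕ → X} (hu : Tendsto u atTop (𝓝 x))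
    (hω : ∀ n, ∀ᶠ m in atTop, θ.expansion (u m) n = ω n) : θ.Represents ω x := by
  intro n
  have hlim := ((continuous_level n).tendsto x).comp hu
  refine ⟨fun h => le_of_tendsto hlim ?_, fun h => ge_of_tendsto hlim ?_⟩ <;>
    filter_upwards [hω n] with m hm <;> rw [h] at hm
  · exact (of_decide_eq_true hm).le
  · exact not_lt.1 (of_decide_eq_false hm)

theorem exists_represents (hω : ω ∈ θ.codes) : ∃ x, θ.Represents ω x := by
  choose i j hone hagree using hω
  let u : ℕ → X := fun N => ComputableMetricSpace.ideal (j N)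
  have hexp : ∀ n N, n ≤ N → θ.expansion (u N) n = ω n := fun n N h =>
    (hagree N n (h.trans (Nat.right_le_pair _ _))).symm
  have hclose : ∀ k N, Nat.pair (i k) k ≤ N →
      dist (ComputableMetricSpace.ideal (i k)) (u N) ≤ 2 * (1 / 2) ^ k := by
    intro k N hN
    have hdigit : θ.expansion (u N) (Nat.pair (i k) k) = true := by
      rw [hexp _ _ hN, hagree k _ le_rfl, hone k]
    exact dist_le_of_level_le (of_decide_eq_true hdigit).le
  have hcauchy : CauchySeq u := by
    refine Metric.cauchySeq_iff'.2 fun ε hε => ?_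
    obtain ⟨k, hk⟩ := exists_pow_lt_of_lt_one (div_pos hε four_pos) (by norm_num : (1 / 2 : ℝ) < 1)
    refine ⟨Nat.pair (i k) k, fun N hN => ?_⟩
    linarith [hclose k N hN, hclose k _ le_rfl, (lt_div_iff₀ four_pos).1 hk,
      dist_triangle_left (u N) (u (Nat.pair (i k) k)) (ComputableMetricSpace.ideal (i k))]
  obtain ⟨x, hx⟩ := cauchySeq_tendsto_of_complete hcauchy
  exact ⟨x, represents_of_tendsto hx fun n => (eventually_ge_atTop n).mono fun N hN => hexp n N hN⟩

theorem mem_codes_of_tendsto {j : ℕ → ℕ}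
    (hj : Tendsto (fun m => (ComputableMetricSpace.ideal (j m) : X)) atTop (𝓝 x))
    (hω : ∀ n, ∀ᶠ m in atTop, θ.expansion (ComputableMetricSpace.ideal (j m)) n = ω n) :
    ω ∈ θ.codes := by
  intro N
  obtain ⟨i, hi⟩ := ComputableMetricSpace.denseRange_ideal.exists_dist_lt x
    (show (0 : ℝ) < (1 / 2) ^ N by positivity)
  have hlevel := (((continuous_level _).tendsto x).comp hj).eventually_lt_const
    (level_lt_of_dist_lt (θ := θ) hi)
  have hprefix := (Set.finite_Iic (Nat.pair i N)).eventually_all.2 fun n _ => hω n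
  obtain ⟨m, hm, hagree⟩ := (hlevel.and hprefix).exists
  exact ⟨i, j m, decide_eq_true hm, fun n hn => (hagree n hn).symm⟩

variable (θ)

/-- The decoding map: the point represented by a sequence of the set of codes. -/
noncomputable def decode (ω : θ.codes) : X := (exists_represents ω.2).choose

theorem represents_decode (ω : θ.codes) : θ.Represents ω (θ.decode ω) :=
  (exists_represents ω.2).choose_spec

theorem surjective_decode : Function.Surjective θ.decode := by
  intro x
  obtain ⟨u, hu, hux⟩ := mem_closure_iff_seq_limit.1 (ComputableMetricSpace.denseRange_ideal x)
  choose j hj using hu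
  obtain ⟨ω, φ, hφ, hω⟩ := CompactSpace.tendsto_subseq fun m => θ.expansion (u m)
  have hdigit : ∀ n, ∀ᶠ m in atTop, θ.expansion (u (φ m)) n = ω n := fun n => by
    have hn := tendsto_pi_nhds.1 hω n
    rwa [nhds_discrete, tendsto_pure] at hn
  have hlim := hux.comp hφ.tendsto_atTop
  simp only [Function.comp_def, ← hj] at hlim hdigit
  have hmem := mem_codes_of_tendsto hlim hdigit
  exact ⟨⟨ω, hmem⟩, (θ.represents_decode ⟨ω, hmem⟩).unique hmem (represents_of_tendsto hlim hdigit)⟩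

variable {θ}

theorem decode_eq_iff (hx : x ∈ θ.regular) (ω : θ.codes) :
    θ.decode ω = x ↔ (ω : ℕ → Bool) = θ.expansion x := by
  constructor
  · rintro rfl
    exact (θ.represents_decode ω).eq_expansion hx
  · intro h
    obtain ⟨ω', rfl⟩ := θ.surjective_decode x
    have h' := (θ.represents_decode ω').eq_expansion hx
    rw [Subtype.ext (h.trans h'.symm)]

theorem expansion_mem_codes (hx : x ∈ θ.regular) : θ.expansion x ∈ θ.codes := by
  obtain ⟨ω, rfl⟩ := θ.surjective_decode x
  rw [← (decode_eq_iff hx ω).1 rfl]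
  exact ω.2

theorem mem_dyadicBall_digits {l n j : ℕ}
    (h : θ.approx.separated (θ.T l) (θ.a l) n j = true) :
    ω ∈ idealBall (ℕ → Bool) (dyadicBall (θ.approx.digits (θ.T l) (θ.a l) n j) n) ↔
      ∀ i ≤ n, ω i = θ.expansion (ComputableMetricSpace.ideal j) i := by
  rw [idealBall_dyadicBall, cantor_mem_ball]
  refine forall₂_congr fun i hi => ?_
  rw [← θ.testBit_digits_of_separated h (by rw [dist_self]; positivity) hi]
  rfl

variable (θ)

theorem isPiZeroTwo_codes : IsPiZeroTwo θ.codes := by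
  refine ⟨fun N => {ω | ∃ i j, θ.expansion (ComputableMetricSpace.ideal j) (Nat.pair i N) = true ∧
      ∀ n ≤ Nat.pair i N, ω n = θ.expansion (ComputableMetricSpace.ideal j) n},
    uniformlyREOpen_of_computable
      (P := fun N p =>
        let i := p.unpair.1; let j := p.unpair.2.unpair.1; let l := p.unpair.2.unpair.2
        θ.approx.separated (θ.T l) (θ.a l) (Nat.pair i N) j &&
          (θ.approx.digits (θ.T l) (θ.a l) (Nat.pair i N) j).testBit (Nat.pair i N))
      (g := fun N p =>
        let i := p.unpair.1; let j := p.unpair.2.unpair.1; let l := p.unpair.2.unpair.2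
        dyadicBall (θ.approx.digits (θ.T l) (θ.a l) (Nat.pair i N) j) (Nat.pair i N))
      (by fun_prop) (by fun_prop) fun N ω => ?_, Set.ofPred_forall _⟩
  have hdigit : ∀ {i j l : ℕ}, θ.approx.separated (θ.T l) (θ.a l) (Nat.pair i N) j = true →
      (θ.approx.digits (θ.T l) (θ.a l) (Nat.pair i N) j).testBit (Nat.pair i N) =
        θ.expansion (ComputableMetricSpace.ideal j) (Nat.pair i N) := fun hs =>
    θ.testBit_digits_of_separated hs (by rw [dist_self]; positivity) le_rfl
  constructor
  · rintro ⟨i, j, hone, hagree⟩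
    obtain ⟨l, hl⟩ := (θ.eventually_separated (θ.ideal_mem_regular j) (Nat.pair i N)).exists
    have hs := hl j (by rw [dist_self]; positivity)
    refine ⟨Nat.pair i (Nat.pair j l), ?_⟩
    simp only [Nat.unpair_pair, Bool.and_eq_true, hdigit hs, mem_dyadicBall_digits hs]
    exact ⟨⟨hs, hone⟩, hagree⟩
  · rintro ⟨p, hp, hω⟩
    rw [Bool.and_eq_true] at hp
    exact ⟨_, _, (hdigit hp.1).symm.trans hp.2, (mem_dyadicBall_digits hp.1).1 hω⟩

theorem computableOn_decode : ComputableOn θ.decode := by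
  refine computableOn_of_queries (q := fun l => l + 2)
    (g := fun m l a => bif decide (l.unpair.2 = m + 2) && a.testBit l
      then some l.unpair.1 else none)
    (by fun_prop) (by fun_prop) (fun ω σ hσ m => ?_) fun ω σ hσ m l b hb => ?_
  · obtain ⟨i, hi⟩ := exists_apply_eq_true ω.2 (m + 2)
    exact ⟨Nat.pair i (m + 2), by simp [hσ.testBit_eq, hi]⟩
  · rw [hσ.testBit_eq] at hb
    obtain ⟨⟨hl, hω⟩, rfl⟩ : (l.unpair.2 = m + 2 ∧ (ω : ℕ → Bool) l = true) ∧ l.unpair.1 = b := by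
      simpa [Bool.cond_eq_ite] using hb
    rw [← Nat.pair_unpair l, hl] at hω
    refine ((θ.represents_decode ω).dist_le hω).trans_eq ?_
    rw [pow_succ (1 / 2 : ℝ) (m + 1)]
    ring

theorem ae_mem_regular : ∀ᵐ x ∂(μ : Measure X), x ∈ θ.regular :=
  (prob_compl_eq_zero_iff θ.isPiZeroTwo_regular.measurableSet).2 θ.measure_regular

theorem measure_codes : (θ.law : Measure (ℕ → Bool)) θ.codes = 1 := by
  rw [θ.law_apply θ.isPiZeroTwo_codes.measurableSet]
  exact le_antisymm prob_le_one (θ.measure_regular.symm.trans_le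
    (measure_mono fun x hx => expansion_mem_codes hx))

/-- The decoding map as a morphism from the distribution of the expansions. -/
noncomputable def decodeMorphism : Morphism θ.law μ where
  dom := θ.codes
  toFun := θ.decode
  isPiZeroTwo_dom := θ.isPiZeroTwo_codes
  measure_dom := θ.measure_codes
  computable := θ.computableOn_decode
  measure_preimage A hA := by
    rw [θ.law_apply (measurableSet_subtype_preimage θ.isPiZeroTwo_codes.measurableSet
      θ.computableOn_decode.continuous.measurable hA)]
    refine measure_congr (θ.ae_mem_regular.mono fun x hx => propext ?_)
    have hdecode : θ.decode ⟨_, expansion_mem_codes hx⟩ = x := (decode_eq_iff hx _).2 rfl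
    change x ∈ A ↔ ∃ h, θ.decode ⟨θ.expansion x, h⟩ ∈ A
    rw [exists_prop_of_true (expansion_mem_codes hx), hdecode]

/-- The binary representation defined by a threshold. -/
noncomputable def binaryRepresentation : BinaryRepresentation μ where
  measure := θ.law
  isComputableMeasure := θ.isComputableMeasure_law
  toMorphism := θ.decodeMorphism
  surjective := θ.surjective_decode
  D := θ.regular
  dense_D := θ.dense_regular
  measure_D := θ.measure_regular
  isPiZeroTwo_D := θ.isPiZeroTwo_regular
  inverse x := θ.expansion x
  fiber_eq x := by
    ext ω
    constructor
    · rintro ⟨h, hω⟩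
      exact (decode_eq_iff x.2 ⟨ω, h⟩).1 hω
    · rintro rfl
      exact ⟨expansion_mem_codes x.2, (decode_eq_iff x.2 _).2 rfl⟩
  computable_inverse := θ.computableOn_expansion

end Threshold

end Decoding

end ComputableProbability

theorem mainTheorem1 {X : Type*} [MetricSpace X] [ComputableMetricSpace X]
    [MeasurableSpace X] [BorelSpace X] (μ : ProbabilityMeasure X) (hμ : IsComputableMeasure μ) :
    Nonempty (BinaryRepresentation μ) ∧
      (∀ R : BinaryRepresentation μ, ∃ I : Isomorphism R.measure μ,
        I.hom = R.toMorphism ∧ I.inv.dom = R.D ∧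
          ∀ x : I.inv.dom, R.toMorphism.fiber (x : X) = {I.inv.toFun x}) ∧
      ∃ ν : ProbabilityMeasure (ℕ → Bool), IsComputableMeasure ν ∧ Nonempty (Isomorphism ν μ) := by
  obtain ⟨θ⟩ := nonempty_threshold hμ
  let R := θ.binaryRepresentation
  exact ⟨⟨R⟩, fun R => ⟨R.isomorphism, rfl, rfl, R.fiber_eq⟩,
    R.measure, R.isComputableMeasure, ⟨R.isomorphism⟩⟩
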